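/- **Theorem 1.** Let $2\le s\le m\le k$ be integers. For a real $\beta$ let $\chi^2_1(\beta^2)$ be the noncentral chi-squared distribution with one degree of freedom and noncentrality parameter $\beta^2$, that is, the law of the square of an $N(\beta,1)$ variable, and for $\beta=\pm\infty$ let it be the point mass at $+\infty$. For $\underline\beta=(\beta_1,\dots,\beta_k)\in[-\infty,\infty]^k$ let $X_1\le\dots\le X_k$ be, under $P_{\underline\beta}$, the order statistics of independent random variables with the distributions $\chi^2_1(\beta_i^2)$, $1\le i\le k$. Let $H_{0,m}$ be the set of those $\underline\beta$ that have at least $m$ components equal to zero, and let $\underline\beta_m=(0,\dots,0,+\infty,\dots,+\infty)\in H_{0,m}$, with $m$ zeros followed by $k-m$ components $+\infty$. Let $T_L:\mathbb R^{s-1}\to\mathbb R$ and $T_R:\mathbb R\to\mathbb R$ be coordinatewise nondecreasing on positive arguments, let $T_R(y)\neq0$ for all $y>0$, and let $T_L/T_R$ be scale invariant: $$\frac{T_L(ax_1,\dots,ax_{s-1})}{T_R(ay)}=\frac{T_L(x_1,\dots,x_{s-1})}{T_R(y)}\qquad\text{for all } a,x_1,\dots,x_{s-1},y>0 .$$ Then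 for the rejection region $R=\{T_L(X_1,\dots,X_{s-1})<T_R(X_s)\}$ $$\sup_{\underline\beta\in H_{0,m}\cap\mathbb R^k}P_{\underline\beta}(R)=\max_{\underline\beta\in H_{0,m}}P_{\underline\beta}(R)=P_{\underline\beta_m}(R).$$ -/

import Mathlib

open MeasureTheory ProbabilityTheory

/-- The law of the square of an `N(β, 1)` variable, i.e. the noncentral chi-squared distribution
with one degree of freedom and noncentrality parameter `β ^ 2`, as a measure on `[0, ∞]`.
For an infinite effect `β = ±∞` it is the point mass at `+∞`. -/
noncomputable def noncentralChiSq (β : EReal) : Measure ENNReal :=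
  if β = ⊤ ∨ β = ⊥ then Measure.dirac ⊤
  else (gaussianReal β.toReal 1).map (fun x : ℝ => ENNReal.ofReal (x ^ 2))

/-- The joint law `P_β` of `k` independent variables with laws `χ²₁(β₁²), …, χ²₁(β_k²)`. -/
noncomputable def sampleLaw {k : ℕ} (β : Fin k → EReal) : Measure (Fin k → ENNReal) :=
  Measure.pi (fun i => noncentralChiSq (β i))

/-- The order statistics of a sample, in nondecreasing order; the index starts at `0`, so that
`orderStat x i` is the `(i+1)`-st smallest value. -/
noncomputable def orderStat {k : ℕ} (x : Fin k → ENNReal) (i : Fin k) : ENNReal :=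
  x (Tuple.sort x i)

/-- The number of zero effects. -/
noncomputable def numZeros {k : ℕ} (β : Fin k → EReal) : ℕ :=
  (Finset.univ.filter (fun i => β i = 0)).card

/-- The null hypothesis `H_{0,m}`, with extended-real effects: at least `m` effects are zero. -/
def nullHyp (k m : ℕ) : Set (Fin k → EReal) := {β | m ≤ numZeros β}

/-- The configuration `(0, …, 0, +∞, …, +∞)` whose first `m` components are zero. -/
noncomputable def leastFavorable (k m : ℕ) : Fin k → EReal :=
  fun i => if (i : ℕ) < m then 0 else ⊤

/-- The rejection region `T_L(X_1, …, X_{s-1}) < T_R(X_s)` in the sample space. When at least `s`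
effects are finite, `X_1, …, X_s` are almost surely finite and positive, so that `toReal` and the
values of `T_L`, `T_R` off the positive reals are immaterial. -/
def rejectionRegion {k s : ℕ} (hs : 1 < s) (hsk : s ≤ k)
    (TL : (Fin (s - 1) → ℝ) → ℝ) (TR : ℝ → ℝ) : Set (Fin k → ENNReal) :=
  {x | TL (fun i => (orderStat x ⟨i, by omega⟩).toReal) <
    TR (orderStat x ⟨s - 1, by omega⟩).toReal}

/-!
Write `s = n + 1`. By scale invariance (`exists_lowerSet_upperSet`) rejection means that the ratios
`X_i / X_s`, `i < s`, lie in a lower set `Q`, and that `X_s` lies in an upper set `V`; one of the two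
conditions is void. The proof conditions on `X_s = t`. The smaller values are then independent
variables conditioned to lie below `t`, and their ratios to `t` are compared through the monotone
likelihood ratio of squared Gaussian variables (`gaussianSq_lowerSet_mul_le`): for a noncentral
variable the ratio is stochastically larger than for a central one, and for a central one it
decreases stochastically in `t`. Since dominance passes to products (`pi_lowerSet_mul_le`), the
conditional rejection probability is at most that of central variables, `condRejProb Q V t`, which
is nondecreasing in `t`. Hence `P_β(R) ≤ E_β (condRejProb Q V X_s)` (`sampleLaw_ratioRegion_le`),
with equality if all effects are zero or infinite (`sampleLaw_ratioRegion_eq`). Making nonzero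
effects infinite increases `X_s` (`lintegral_orderStat_le_leastFavorable`), which gives the bound.

Conditioning on `X_s` is carried out by splitting the sample space according to the set `J` of
indices of the `n` smallest values: on this event `X_s` is the minimum of the remaining values,
which are independent of the values indexed by `J`, so that Tonelli's theorem applies.

`TL` is merely monotone, so the rejection region need not be Borel. It lies, up to null sets, between
the regions defined by the interior and the closure of `Q`, which have the same probability under
the least favourable configuration, because the frontier of a lower set is Lebesgue null
(`condRejProb_closure_eq_interior`). Finally the supremum over real effects is approached along
`(0, …, 0, b, …, b)` as `b → ∞`: outside an event of vanishing probability the last `k - m` values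
exceed the first `m` ones, and then they do not enter the test (`sampleLaw_leastFavorable_le`).
-/

/-! ### Order statistics -/

theorem monotone_orderStat {k : ℕ} (x : Fin k → ENNReal) : Monotone (orderStat x) :=
  Tuple.monotone_sort x

theorem orderStat_comp_perm {k : ℕ} (x : Fin k → ENNReal) (σ : Equiv.Perm (Fin k)) :
    orderStat (x ∘ σ) = orderStat x :=
  Tuple.comp_perm_comp_sort_eq_comp_sort

/-- The order statistics are the only nondecreasing rearrangement of the sample. -/
theorem orderStat_eq_of_monotone {k : ℕ} {x : Fin k → ENNReal} (σ : Equiv.Perm (Fin k))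
    (h : Monotone (x ∘ σ)) : orderStat x = x ∘ σ :=
  (Tuple.comp_sort_eq_comp_iff_monotone.mpr h).symm

theorem orderStat_comp_monotone {k : ℕ} (x : Fin k → ENNReal) {f : ENNReal → ENNReal}
    (hf : Monotone f) : orderStat (f ∘ x) = f ∘ orderStat x :=
  orderStat_eq_of_monotone (Tuple.sort x) (hf.comp (monotone_orderStat x))

/-- A min-max formula for order statistics, from which their monotonicity and measurability
are read off. -/
theorem orderStat_eq_iInf {k : ℕ} (x : Fin k → ENNReal) (i : Fin k) :
    orderStat x i = ⨅ σ : Equiv.Perm (Fin k), ⨆ j : Set.Iic i, x (σ j) := by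
  apply le_antisymm
  · refine le_iInf fun σ => ?_
    -- among the `i + 1` indices `σ j`, `j ≤ i`, one has rank at least `i`
    obtain ⟨j, hji, hj⟩ : ∃ j ≤ i, i ≤ (Tuple.sort x).symm (σ j) := by
      by_contra! hcon
      have hle := Finset.card_le_card_of_injOn (s := Finset.Iic i) (t := Finset.Iio i)
        (fun j => (Tuple.sort x).symm (σ j))
        (fun j hj => by simpa using hcon j (by simpa using hj))
        (((Tuple.sort x).symm.injective.comp σ.injective).injOn)
      simp at hle
    calc orderStat x i ≤ orderStat x ((Tuple.sort x).symm (σ j)) := monotone_orderStat x hj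
      _ = x (σ j) := by simp [orderStat]
      _ ≤ _ := le_iSup (fun j : Set.Iic i => x (σ j)) ⟨j, hji⟩
  · exact iInf_le_of_le (Tuple.sort x) (iSup_le fun j => monotone_orderStat x j.2)

theorem orderStat_mono {k : ℕ} {x y : Fin k → ENNReal} (h : x ≤ y) (i : Fin k) :
    orderStat x i ≤ orderStat y i := by
  rw [orderStat_eq_iInf, orderStat_eq_iInf]
  exact iInf_mono fun σ => iSup_mono fun j => h _

theorem measurable_orderStat {k : ℕ} (i : Fin k) :
    Measurable fun x : Fin k → ENNReal => orderStat x i := by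
  simp_rw [orderStat_eq_iInf]
  exact Measurable.iInf fun σ => Measurable.iSup fun j => measurable_pi_apply _

/-- If a sample splits into two blocks of sizes `n` and `r`, the first lying below the second, its
order statistics are those of the first block followed by those of the second. -/
theorem orderStat_split {n r k : ℕ} (hk : n + r = k) (e : Fin n ⊕ Fin r ≃ Fin k)
    (x : Fin k → ENNReal) (h : ∀ a b, x (e (Sum.inl a)) ≤ x (e (Sum.inr b))) :
    (∀ a : Fin n, orderStat x ⟨a, by omega⟩ = orderStat (fun a => x (e (Sum.inl a))) a) ∧
    ∀ b : Fin r, orderStat x ⟨n + b, by omega⟩ = orderStat (fun b => x (e (Sum.inr b))) b := by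
  subst hk
  set u := fun a => x (e (Sum.inl a)) with hu
  set z := fun b => x (e (Sum.inr b)) with hz
  let σ : Equiv.Perm (Fin (n + r)) :=
    (finSumFinEquiv.symm.trans (Equiv.sumCongr (Tuple.sort u) (Tuple.sort z))).trans e
  have hl : ∀ a : Fin n, (x ∘ σ) (Fin.castAdd r a) = orderStat u a := by
    intro a; simp [σ, orderStat, hu]
  have hr : ∀ b : Fin r, (x ∘ σ) (Fin.natAdd n b) = orderStat z b := by
    intro b; simp [σ, orderStat, hz]
  have hmono : Monotone (x ∘ σ) := by
    intro i j hij
    induction i using Fin.addCases with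
    | left a =>
      induction j using Fin.addCases with
      | left a' => rw [hl, hl]; exact monotone_orderStat u hij
      | right b => rw [hl, hr]; exact h _ _
    | right b =>
      induction j using Fin.addCases with
      | left a' =>
        exfalso
        have : n + (b : ℕ) ≤ a' := hij
        omega
      | right b' =>
        rw [hr, hr]
        refine monotone_orderStat z ?_
        have : n + (b : ℕ) ≤ n + b' := hij
        exact Fin.le_def.mpr (by omega)
  have heq := orderStat_eq_of_monotone σ hmono
  exact ⟨fun a => by rw [← hl, ← heq]; rfl, fun b => by rw [← hr, ← heq]; rfl⟩

theorem orderStat_zero_eq_iInf {r : ℕ} (z : Fin (r + 1) → ENNReal) :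
    orderStat z 0 = ⨅ b, z b := by
  apply le_antisymm
  · refine le_iInf fun b => ?_
    calc orderStat z 0 ≤ orderStat z ((Tuple.sort z).symm b) :=
          monotone_orderStat z (Fin.zero_le _)
      _ = z b := by simp [orderStat]
  · exact iInf_le _ _

/-! ### Stochastic dominance for product measures -/

/-- If `μ` and `ν` compare, up to the factors `b` and `a`, on the lower sets contained in `B`, their
integrals of antitone functions vanishing off `B` compare in the same way. -/
theorem lintegral_antitone_mul_le {μ ν : Measure ENNReal} {a b : ENNReal} (ha : a ≠ ⊤) (hb : b ≠ ⊤)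
    {B : Set ENNReal} (h : ∀ A, IsLowerSet A → A ⊆ B → μ A * b ≤ ν A * a)
    {f : ENNReal → ENNReal} (hf : Antitone f) (hfin : ∀ x, f x ≠ ⊤) (h0 : ∀ x ∉ B, f x = 0) :
    (∫⁻ x, f x ∂μ) * b ≤ (∫⁻ x, f x ∂ν) * a := by
  have key : ∀ ρ : Measure ENNReal,
      ∫⁻ x, f x ∂ρ = ∫⁻ t in Set.Ioi (0 : ℝ), ρ {x | t < (f x).toReal} := by
    intro ρ
    rw [← lintegral_eq_lintegral_meas_lt ρ (Filter.Eventually.of_forall fun x => by simp)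
      hf.measurable.ennreal_toReal.aemeasurable]
    simp [hfin]
  rw [key, key, ← lintegral_mul_const' _ _ hb, ← lintegral_mul_const' _ _ ha]
  refine setLIntegral_mono_ae' measurableSet_Ioi (Filter.Eventually.of_forall fun t ht => h _ ?_ ?_)
  · intro x y hyx hx
    exact lt_of_lt_of_le hx (ENNReal.toReal_mono (hfin y) (hf hyx))
  · intro x hx
    by_contra hxB
    have hx' : t < (f x).toReal := hx
    rw [h0 x hxB] at hx'
    exact absurd ht (by simpa using hx'.le)

/-- Stochastic dominance passes to product measures. -/
theorem pi_lowerSet_mul_le {n : ℕ} (μ ν : Fin n → Measure ENNReal) [∀ i, IsFiniteMeasure (μ i)]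
    [∀ i, IsFiniteMeasure (ν i)] (a b : Fin n → ENNReal) (ha : ∀ i, a i ≠ ⊤) (hb : ∀ i, b i ≠ ⊤)
    {B : Set ENNReal} (h : ∀ i, ∀ A, IsLowerSet A → A ⊆ B → μ i A * b i ≤ ν i A * a i)
    {D : Set (Fin n → ENNReal)} (hD : IsLowerSet D) (hDm : MeasurableSet D)
    (hDB : ∀ u ∈ D, ∀ i, u i ∈ B) :
    Measure.pi μ D * ∏ i, b i ≤ Measure.pi ν D * ∏ i, a i := by
  induction n with
  | zero =>
    have : Measure.pi μ = Measure.pi ν := by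
      congr 1; funext i; exact i.elim0
    simp [this]
  | succ n ih =>
    have split : ∀ (ρ : Fin (n + 1) → Measure ENNReal) [∀ i, IsFiniteMeasure (ρ i)],
        Measure.pi ρ D =
          ∫⁻ x, Measure.pi (fun i : Fin n => ρ i.succ) {w | Fin.cons x w ∈ D} ∂(ρ 0) := by
      intro ρ _
      have hmp := (measurePreserving_piFinSuccAbove ρ 0).symm
      rw [← hmp.measure_preimage_equiv, Measure.prod_apply
        ((MeasurableEquiv.measurable _) hDm)]
      refine lintegral_congr fun x => congrArg _ ?_
      ext w
      simp [MeasurableEquiv.piFinSuccAbove, Fin.insertNthEquiv]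
    have hsm : ∀ x, MeasurableSet {w : Fin n → ENNReal | (Fin.cons x w : Fin (n + 1) → ENNReal) ∈ D} := by
      intro x
      refine hDm.preimage (measurable_pi_iff.mpr fun i => ?_)
      refine Fin.cases ?_ (fun j => ?_) i
      · simp
      · simpa using measurable_pi_apply j
    have hsl : ∀ x, IsLowerSet {w : Fin n → ENNReal | (Fin.cons x w : Fin (n + 1) → ENNReal) ∈ D} := by
      intro x w w' hw hwD
      exact hD (Fin.cons_le_cons.mpr ⟨le_rfl, hw⟩) hwD
    have hstep := fun x => ih (fun i => μ i.succ) (fun i => ν i.succ) (fun i => a i.succ)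
      (fun i => b i.succ) (fun i => ha _) (fun i => hb _) (fun i => h i.succ) (hsl x) (hsm x)
      (fun w hw i => by simpa using hDB _ hw i.succ)
    have hpa : ∏ i : Fin n, a i.succ ≠ ⊤ := ENNReal.prod_ne_top fun i _ => ha _
    have hpb : ∏ i : Fin n, b i.succ ≠ ⊤ := ENNReal.prod_ne_top fun i _ => hb _
    rw [split μ, split ν, Fin.prod_univ_succ, Fin.prod_univ_succ]
    set F := fun x => Measure.pi (fun i : Fin n => μ i.succ) {w | Fin.cons x w ∈ D}
    set G := fun x => Measure.pi (fun i : Fin n => ν i.succ) {w | Fin.cons x w ∈ D}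
    have hG : Antitone G := fun x y hxy => measure_mono fun w hw =>
      hD (Fin.cons_le_cons.mpr ⟨hxy, le_rfl⟩) hw
    calc (∫⁻ x, F x ∂(μ 0)) * (b 0 * ∏ i : Fin n, b i.succ)
        = (∫⁻ x, F x * ∏ i : Fin n, b i.succ ∂(μ 0)) * b 0 := by
          rw [lintegral_mul_const' _ _ hpb]; ring
      _ ≤ (∫⁻ x, G x * ∏ i : Fin n, a i.succ ∂(μ 0)) * b 0 := by
          gcongr ?_ * _; exact lintegral_mono hstep
      _ = ((∫⁻ x, G x ∂(μ 0)) * b 0) * ∏ i : Fin n, a i.succ := by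
          rw [lintegral_mul_const' _ _ hpa]; ring
      _ ≤ ((∫⁻ x, G x ∂(ν 0)) * a 0) * ∏ i : Fin n, a i.succ := by
          gcongr ?_ * _
          refine lintegral_antitone_mul_le (ha 0) (hb 0) (h 0) hG (fun x => measure_ne_top _ _) ?_
          intro x hx
          have : {w : Fin n → ENNReal | (Fin.cons x w : Fin (n + 1) → ENNReal) ∈ D} = ∅ := by
            ext w
            simp only [Set.mem_ofPred_eq, Set.mem_empty_iff_false, iff_false]
            exact fun hw => hx (by simpa using hDB _ hw 0)
          simp [G, this]
      _ = _ := by ring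

/-! ### Monotone likelihood ratio of squared Gaussian variables -/

/-- If the ratio `ρ` of two densities is at most its values off `A` on `A`, then the measure with
density `ρ * g` gives a smaller share of `B ⊇ A` to `A`. -/
theorem lintegral_mul_le_of_ratio {α : Type*} [MeasurableSpace α] {μ : Measure α}
    {ρ g : α → ENNReal} (hg : Measurable g) {A B : Set α}
    (hA : MeasurableSet A) (hB : MeasurableSet B) (hAB : A ⊆ B)
    (h : ∀ x ∈ A, ∀ y ∉ A, ρ x ≤ ρ y) :
    (∫⁻ x in A, ρ x * g x ∂μ) * (∫⁻ x in B, g x ∂μ) ≤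
      (∫⁻ x in A, g x ∂μ) * ∫⁻ x in B, ρ x * g x ∂μ := by
  set c := ⨆ x ∈ A, ρ x
  have h1 : ∫⁻ x in A, ρ x * g x ∂μ ≤ c * ∫⁻ x in A, g x ∂μ := by
    rw [← lintegral_const_mul c hg]
    exact setLIntegral_mono_ae' hA (Filter.Eventually.of_forall fun x hx => by
      gcongr; exact le_iSup₂ (f := fun x (_ : x ∈ A) => ρ x) x hx)
  have h2 : c * ∫⁻ x in B \ A, g x ∂μ ≤ ∫⁻ x in B \ A, ρ x * g x ∂μ := by
    rw [← lintegral_const_mul c hg]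
    exact setLIntegral_mono_ae' (hB.diff hA) (Filter.Eventually.of_forall fun x hx => by
      gcongr; exact iSup₂_le fun y hy => h y hy x hx.2)
  have hs : ∀ f : α → ENNReal,
      ∫⁻ x in B, f x ∂μ = ∫⁻ x in A, f x ∂μ + ∫⁻ x in B \ A, f x ∂μ := by
    intro f
    rw [← lintegral_inter_add_sdiff f B hA, Set.inter_eq_self_of_subset_right hAB]
  rw [hs g, hs (fun x => ρ x * g x), mul_add, mul_add]
  refine add_le_add (mul_comm _ _).le ?_
  calc (∫⁻ x in A, ρ x * g x ∂μ) * ∫⁻ x in B \ A, g x ∂μ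
      ≤ (c * ∫⁻ x in A, g x ∂μ) * ∫⁻ x in B \ A, g x ∂μ := by gcongr
    _ = (∫⁻ x in A, g x ∂μ) * (c * ∫⁻ x in B \ A, g x ∂μ) := by ring
    _ ≤ _ := by gcongr

/-- Squares of Gaussian variables have monotone likelihood ratio in the variance and, compared with a
centred variable, in the mean: the share of `B` falling to a smaller lower set `A` is smaller under
`N(a, v)` than under `N(0, v')` if `v' ≤ v`. -/
theorem gaussianSq_lowerSet_mul_le (a : ℝ) {v v' : NNReal} (hv' : v' ≠ 0) (hvv : v' ≤ v)
    {A B : Set ENNReal} (hA : IsLowerSet A) (hB : IsLowerSet B) (hAB : A ⊆ B) :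
    (gaussianReal a v).map (fun x : ℝ => ENNReal.ofReal (x ^ 2)) A *
        (gaussianReal 0 v').map (fun x : ℝ => ENNReal.ofReal (x ^ 2)) B ≤
      (gaussianReal 0 v').map (fun x : ℝ => ENNReal.ofReal (x ^ 2)) A *
        (gaussianReal a v).map (fun x : ℝ => ENNReal.ofReal (x ^ 2)) B := by
  have hv'0 : 0 < v' := pos_iff_ne_zero.mpr hv'
  have hv0 : 0 < v := hv'0.trans_le hvv
  have hv : v ≠ 0 := hv0.ne'
  have hsq : Measurable fun x : ℝ => ENNReal.ofReal (x ^ 2) := by fun_prop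
  set ρ : ℝ → ENNReal := fun x => ENNReal.ofReal
    (√(2 * Real.pi * v') / √(2 * Real.pi * v) * Real.exp (-a ^ 2 / (2 * v)) *
      Real.exp (x ^ 2 * (1 / (2 * v') - 1 / (2 * v))) * Real.cosh (a / v * x))
  have hpdf : ∀ x, (gaussianPDF a v x + gaussianPDF (-a) v x) = 2 * (ρ x * gaussianPDF 0 v' x) := by
    intro x
    have h2 : (2 : ENNReal) = ENNReal.ofReal 2 := by simp
    simp only [gaussianPDF, ρ]
    rw [← ENNReal.ofReal_add (gaussianPDFReal_nonneg _ _ _) (gaussianPDFReal_nonneg _ _ _),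
      ← ENNReal.ofReal_mul (by positivity), h2, ← ENNReal.ofReal_mul (by norm_num)]
    congr 1
    simp only [gaussianPDFReal, Real.cosh_eq]
    have e1 : -(x - a) ^ 2 / (2 * v) = -a ^ 2 / (2 * v) +
        (x ^ 2 * (1 / (2 * v') - 1 / (2 * v))) + a / v * x + -(x - 0) ^ 2 / (2 * v') := by
      field_simp; ring
    have e2 : -(x - -a) ^ 2 / (2 * v) = -a ^ 2 / (2 * v) +
        (x ^ 2 * (1 / (2 * v') - 1 / (2 * v))) + -(a / v * x) + -(x - 0) ^ 2 / (2 * v') := by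
      field_simp; ring
    have h0 : √(2 * Real.pi * v') ≠ 0 := by positivity
    rw [e1, e2]
    simp only [Real.exp_add]
    field_simp
  have hρ : ∀ x y : ℝ, x ^ 2 ≤ y ^ 2 → ρ x ≤ ρ y := by
    intro x y hxy
    apply ENNReal.ofReal_le_ofReal
    have hexp : (0 : ℝ) ≤ 1 / (2 * v') - 1 / (2 * v) := by
      rw [sub_nonneg]
      have : (v' : ℝ) ≤ v := hvv
      gcongr
    have hcosh : Real.cosh (a / v * x) ≤ Real.cosh (a / v * y) := by
      rw [Real.cosh_le_cosh, abs_mul, abs_mul]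
      exact mul_le_mul_of_nonneg_left (sq_le_sq.mp hxy) (abs_nonneg _)
    gcongr
  -- the preimage of a set under squaring is symmetric, so only the even part of a density matters
  have hlaw : ∀ S, IsLowerSet S → (gaussianReal a v).map (fun x : ℝ => ENNReal.ofReal (x ^ 2)) S =
      ∫⁻ x in (fun x : ℝ => ENNReal.ofReal (x ^ 2)) ⁻¹' S, ρ x * gaussianPDF 0 v' x := by
    intro S hS
    have hSm : MeasurableSet S := hS.ordConnected.measurableSet
    rw [Measure.map_apply hsq hSm]
    set S' := (fun x : ℝ => ENNReal.ofReal (x ^ 2)) ⁻¹' S with hS'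
    have hneg : gaussianReal (-a) v S' = gaussianReal a v S' := by
      rw [← gaussianReal_map_neg, Measure.map_apply (by fun_prop) (hsq hSm)]
      congr 1
      ext x; simp [hS']
    have h2 : 2 * gaussianReal a v S' =
        2 * ∫⁻ x in S', ρ x * gaussianPDF 0 v' x := by
      rw [two_mul]
      nth_rewrite 2 [← hneg]
      rw [gaussianReal_apply _ hv, gaussianReal_apply _ hv,
        ← lintegral_add_left (measurable_gaussianPDF _ _), ← lintegral_const_mul' _ _ (by simp)]
      exact lintegral_congr fun x => hpdf x
    exact (ENNReal.mul_right_inj (by simp) (by simp)).mp h2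
  have hlaw0 : ∀ S, IsLowerSet S → (gaussianReal 0 v').map (fun x : ℝ => ENNReal.ofReal (x ^ 2)) S =
      ∫⁻ x in (fun x : ℝ => ENNReal.ofReal (x ^ 2)) ⁻¹' S, gaussianPDF 0 v' x := by
    intro S hS
    rw [Measure.map_apply hsq hS.ordConnected.measurableSet, gaussianReal_apply _ hv']
  rw [hlaw A hA, hlaw B hB, hlaw0 A hA, hlaw0 B hB]
  refine lintegral_mul_le_of_ratio (measurable_gaussianPDF _ _)
    (hsq hA.ordConnected.measurableSet) (hsq hB.ordConnected.measurableSet)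
    (Set.preimage_mono hAB) fun x hx y hy => hρ x y ?_
  by_contra! hlt
  exact hy (hA (ENNReal.ofReal_le_ofReal hlt.le) hx)

/-! ### Noncentral chi-squared laws -/

theorem noncentralChiSq_coe (b : ℝ) :
    noncentralChiSq (b : EReal) =
      (gaussianReal b 1).map (fun x : ℝ => ENNReal.ofReal (x ^ 2)) := by
  simp [noncentralChiSq]

theorem noncentralChiSq_zero :
    noncentralChiSq 0 = (gaussianReal 0 1).map (fun x : ℝ => ENNReal.ofReal (x ^ 2)) :=
  mod_cast noncentralChiSq_coe 0

theorem noncentralChiSq_top : noncentralChiSq ⊤ = Measure.dirac ⊤ := by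
  simp [noncentralChiSq]

theorem noncentralChiSq_bot : noncentralChiSq ⊥ = Measure.dirac ⊤ := by
  simp [noncentralChiSq]

instance isProbabilityMeasure_noncentralChiSq (β : EReal) :
    IsProbabilityMeasure (noncentralChiSq β) := by
  unfold noncentralChiSq
  split_ifs
  · infer_instance
  · exact Measure.isProbabilityMeasure_map (by fun_prop)

theorem noncentralChiSq_singleton (β : EReal) {x : ENNReal} (hx : x ≠ ⊤) :
    noncentralChiSq β {x} = 0 := by
  induction β with
  | bot => simp [noncentralChiSq_bot, hx.symm]
  | top => simp [noncentralChiSq_top, hx.symm]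
  | coe b =>
    have := nullSingletonClass_gaussianReal (μ := b) (v := 1) one_ne_zero
    rw [noncentralChiSq_coe, Measure.map_apply (by fun_prop) (measurableSet_singleton x)]
    refine measure_mono_null (t := {√x.toReal, -√x.toReal}) ?_
      (Set.Finite.measure_zero (by simp) _)
    intro y hy
    have hy' : ENNReal.ofReal (y ^ 2) = x := hy
    have : x.toReal = y ^ 2 := by rw [← hy', ENNReal.toReal_ofReal (sq_nonneg y)]
    rw [this, Real.sqrt_sq_eq_abs]
    rcases abs_choice y with h | h <;> simp [h]

theorem noncentralChiSq_singleton_top (b : ℝ) : noncentralChiSq (b : EReal) {⊤} = 0 := by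
  rw [noncentralChiSq_coe, Measure.map_apply (by fun_prop) (measurableSet_singleton _)]
  simp [Set.preimage]

theorem noncentralChiSq_zero_singleton_top : noncentralChiSq 0 {⊤} = 0 :=
  mod_cast noncentralChiSq_singleton_top 0

theorem noncentralChiSq_zero_Iio_pos {t : ENNReal} (ht : 0 < t) :
    0 < noncentralChiSq 0 (Set.Iio t) := by
  rw [noncentralChiSq_zero, Measure.map_apply (by fun_prop) measurableSet_Iio]
  have hopen : IsOpen ((fun x : ℝ => ENNReal.ofReal (x ^ 2)) ⁻¹' Set.Iio t) :=
    isOpen_Iio.preimage (ENNReal.continuous_ofReal.comp (by fun_prop))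
  have hpos := hopen.measure_pos volume ⟨0, by simpa using ht⟩
  rw [pos_iff_ne_zero] at hpos ⊢
  exact fun h => hpos (gaussianReal_absolutelyContinuous' 0 one_ne_zero h)

theorem noncentralChiSq_coe_map_div (b : ℝ) {t : ENNReal} (ht0 : t ≠ 0) (ht : t ≠ ⊤) :
    (noncentralChiSq (b : EReal)).map (· / t) =
      (gaussianReal (b / √t.toReal) t.toNNReal⁻¹).map (fun x : ℝ => ENNReal.ofReal (x ^ 2)) := by
  have htpos : 0 < t.toReal := ENNReal.toReal_pos ht0 ht
  have h1 : gaussianReal (b / √t.toReal) t.toNNReal⁻¹ = (gaussianReal b 1).map (· / √t.toReal) := by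
    rw [gaussianReal_map_div_const]
    congr 1
    ext
    simp [ENNReal.toReal]
  rw [noncentralChiSq_coe, h1, Measure.map_map (by fun_prop) (by fun_prop),
    Measure.map_map (by fun_prop) (by fun_prop)]
  congr 1
  ext x
  simp only [Function.comp_apply, div_pow, Real.sq_sqrt htpos.le]
  rw [ENNReal.ofReal_div_of_pos htpos, ENNReal.ofReal_toReal ht]

/-- Relative to the threshold `t`, a noncentral variable conditioned to lie below `t` is
stochastically larger than a central one conditioned to lie below a larger threshold `t'`. -/
theorem noncentralChiSq_map_div_mul_le (β : EReal) {t t' : ENNReal} (ht0 : t ≠ 0) (htt : t ≤ t')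
    (ht' : t' ≠ ⊤) {A : Set ENNReal} (hA : IsLowerSet A) (hA1 : A ⊆ Set.Iio 1) :
    (noncentralChiSq β).map (· / t) A * (noncentralChiSq 0).map (· / t') (Set.Iio 1) ≤
      (noncentralChiSq 0).map (· / t') A * (noncentralChiSq β).map (· / t) (Set.Iio 1) := by
  have ht : t ≠ ⊤ := ne_top_of_le_ne_top ht' htt
  have ht'0 : t' ≠ 0 := (ht0.bot_lt.trans_le htt).ne'
  have htop : (Measure.dirac (⊤ : ENNReal)).map (· / t) A = 0 := by
    rw [Measure.map_dirac, Measure.dirac_apply' _ hA.ordConnected.measurableSet, ENNReal.top_div_of_ne_top ht]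
    simpa using fun h => absurd (hA1 h) (by simp)
  induction β with
  | bot => rw [noncentralChiSq_bot, htop]; simp
  | top => rw [noncentralChiSq_top, htop]; simp
  | coe b =>
    have h0 : noncentralChiSq 0 = noncentralChiSq ((0 : ℝ) : EReal) := by simp
    rw [h0, noncentralChiSq_coe_map_div b ht0 ht, noncentralChiSq_coe_map_div 0 ht'0 ht', zero_div]
    refine gaussianSq_lowerSet_mul_le _ ?_ ?_ hA (isLowerSet_Iio 1) hA1
    · simp [ENNReal.toNNReal_eq_zero_iff, ht'0, ht']
    · have : 0 < t.toNNReal := ENNReal.toNNReal_pos ht0 ht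
      have h2 := ENNReal.toNNReal_mono ht' htt
      gcongr

/-- The central chi-squared law, divided by a constant, is absolutely continuous. -/
theorem noncentralChiSq_zero_map_div_toReal_absolutelyContinuous {t : ENNReal}
    (ht0 : t ≠ 0) (ht : t ≠ ⊤) :
    ((noncentralChiSq 0).map (· / t)).map ENNReal.toReal ≪ volume := by
  have h0 : noncentralChiSq 0 = noncentralChiSq ((0 : ℝ) : EReal) := by simp
  rw [h0, noncentralChiSq_coe_map_div 0 ht0 ht, Measure.map_map (by fun_prop) (by fun_prop)]
  have hv : t.toNNReal⁻¹ ≠ 0 := by simp [ENNReal.toNNReal_eq_zero_iff, ht0, ht]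
  refine Measure.AbsolutelyContinuous.mk fun s hs hs0 => ?_
  rw [Measure.map_apply (by fun_prop) hs]
  refine gaussianReal_absolutelyContinuous _ hv ?_
  set s' := s ∩ Set.Ioi 0
  have hs' : volume s' = 0 := measure_mono_null Set.inter_subset_left hs0
  have hd : DifferentiableOn ℝ Real.sqrt s' := fun x hx =>
    (Real.hasDerivAt_sqrt (ne_of_gt hx.2)).differentiableAt.differentiableWithinAt
  have h1 := addHaar_image_eq_zero_of_differentiableOn_of_addHaar_eq_zero volume hd hs'
  have h2 := addHaar_image_eq_zero_of_differentiableOn_of_addHaar_eq_zero volume hd.neg hs'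
  refine measure_mono_null (t := {0} ∪ (Real.sqrt '' s' ∪ (-Real.sqrt) '' s')) ?_
    (measure_union_null (by simp) (measure_union_null h1 h2))
  intro x hx
  have hx' : x ^ 2 ∈ s := by
    simpa [ENNReal.toReal_ofReal (sq_nonneg x)] using hx
  rcases eq_or_ne x 0 with rfl | hx0
  · simp
  · have hxs : x ^ 2 ∈ s' := ⟨hx', by simpa using pow_pos (abs_pos.mpr hx0) 2⟩
    rcases abs_choice x with h | h
    · exact Or.inr (Or.inl ⟨x ^ 2, hxs, by rw [Real.sqrt_sq_eq_abs, h]⟩)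
    · exact Or.inr (Or.inr ⟨x ^ 2, hxs, by simp [Real.sqrt_sq_eq_abs, h]⟩)

/-! ### Almost sure properties of the sample -/

instance isProbabilityMeasure_sampleLaw {k : ℕ} (β : Fin k → EReal) :
    IsProbabilityMeasure (sampleLaw β) := by
  unfold sampleLaw; infer_instance

theorem ae_sampleLaw_ne_zero {k : ℕ} (β : Fin k → EReal) : ∀ᵐ x ∂sampleLaw β, ∀ i, x i ≠ 0 := by
  rw [ae_all_iff]
  intro i
  have h : sampleLaw β (Function.eval i ⁻¹' {0}) = 0 :=
    Measure.pi_eval_preimage_null (fun i => noncentralChiSq (β i)) (s := {0})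
      (noncentralChiSq_singleton (β i) ENNReal.zero_ne_top)
  filter_upwards [measure_eq_zero_iff_ae_notMem.mp h] with x hx
  simpa using hx

theorem ae_sampleLaw_ne_top {k : ℕ} (β : Fin k → EReal) :
    ∀ᵐ x ∂sampleLaw β, ∀ i, β i = 0 → x i ≠ ⊤ := by
  rw [ae_all_iff]
  intro i
  by_cases hi : β i = 0
  · have h : sampleLaw β (Function.eval i ⁻¹' {⊤}) = 0 :=
      Measure.pi_eval_preimage_null (fun i => noncentralChiSq (β i)) (s := {⊤})
        (by rw [hi]; exact noncentralChiSq_zero_singleton_top)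
    filter_upwards [measure_eq_zero_iff_ae_notMem.mp h] with x hx _
    simpa using hx
  · exact Filter.Eventually.of_forall fun x h => absurd h hi

/-- Almost surely, only infinite values are tied. -/
theorem ae_sampleLaw_eq_top_of_eq {k : ℕ} (β : Fin k → EReal) :
    ∀ᵐ x ∂sampleLaw β, ∀ i j, i ≠ j → x i = x j → x i = ⊤ := by
  simp_rw [ae_all_iff]
  intro i j hij
  have hind : IndepFun (fun x : Fin k → ENNReal => x i) (fun x => x j) (sampleLaw β) :=
    (iIndepFun_pi (μ := fun i => noncentralChiSq (β i)) (X := fun _ => id)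
      fun _ => aemeasurable_id).indepFun hij
  have hmap := (indepFun_iff_map_prod_eq_prod_map_map
    (measurable_pi_apply i).aemeasurable (measurable_pi_apply j).aemeasurable).mp hind
  have hev : ∀ i, (sampleLaw β).map (fun x : Fin k → ENNReal => x i) = noncentralChiSq (β i) :=
    fun i => (measurePreserving_eval (fun i => noncentralChiSq (β i)) i).map_eq
  rw [hev, hev] at hmap
  set S : Set (ENNReal × ENNReal) := {p | p.1 = p.2 ∧ p.1 ≠ ⊤} with hS
  have hSm : MeasurableSet S :=
    (measurableSet_eq_fun measurable_fst measurable_snd).inter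
      ((measurableSet_singleton (⊤ : ENNReal)).compl.preimage measurable_fst)
  have h0 : (sampleLaw β).map (fun x : Fin k → ENNReal => (x i, x j)) S = 0 := by
    rw [hmap, Measure.prod_apply hSm, lintegral_eq_zero_iff (measurable_measure_prodMk_left hSm)]
    refine Filter.Eventually.of_forall fun a => ?_
    by_cases ha : a = ⊤
    · simp [hS, ha]
    · refine measure_mono_null (t := {a}) ?_ (noncentralChiSq_singleton _ ha)
      rintro b ⟨hb, -⟩
      exact hb.symm
  rw [Measure.map_apply (by fun_prop) hSm] at h0
  filter_upwards [measure_eq_zero_iff_ae_notMem.mp h0] with x hx hxij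
  by_contra hne
  exact hx ⟨hxij, hne⟩

theorem orderStat_ne_zero {k : ℕ} {x : Fin k → ENNReal} (hx : ∀ i, x i ≠ 0) (i : Fin k) :
    orderStat x i ≠ 0 := hx _

/-- With more than `n` finite values, the `(n + 1)`-st smallest one is finite. -/
theorem orderStat_ne_top {k n : ℕ} (hn : n < k) {β : Fin k → EReal} (hβ : n < numZeros β)
    {x : Fin k → ENNReal} (hx : ∀ i, β i = 0 → x i ≠ ⊤) : orderStat x ⟨n, hn⟩ ≠ ⊤ := by
  intro htop
  have hsub : Finset.univ.filter (fun i => β i = 0) ⊆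
      (Finset.univ : Finset (Fin n)).image (fun a : Fin n => Tuple.sort x ⟨a, by omega⟩) := by
    intro i hi
    have hi0 : β i = 0 := by simpa using hi
    have hlt : (Tuple.sort x).symm i < ⟨n, hn⟩ := by
      by_contra! hle
      have h1 : orderStat x ((Tuple.sort x).symm i) = ⊤ :=
        top_le_iff.mp (htop ▸ monotone_orderStat x hle)
      exact hx i hi0 (by simpa [orderStat] using h1)
    exact Finset.mem_image.mpr ⟨⟨(Tuple.sort x).symm i, hlt⟩, by simp, by simp⟩
  have h1 := Finset.card_le_card hsub
  have h2 : (Finset.image (fun a : Fin n => Tuple.sort x ⟨a, by omega⟩) Finset.univ).card ≤ n :=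
    Finset.card_image_le.trans (by simp)
  have h3 : (Finset.univ.filter fun i => β i = 0).card = numZeros β := rfl
  omega

/-! ### Conditional rejection probabilities -/

/-- Samples of size `n` below `t` whose ordered values, divided by `t`, lie in `Q`. -/
def ratioSet {n : ℕ} (Q : Set (Fin n → ℝ)) (t : ENNReal) : Set (Fin n → ENNReal) :=
  {u | (∀ i, u i < t) ∧ (fun i => (orderStat u i / t).toReal) ∈ Q}

theorem measurableSet_ratioSet {n : ℕ} {Q : Set (Fin n → ℝ)} (hQ : MeasurableSet Q) (t : ENNReal) :
    MeasurableSet (ratioSet Q t) := by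
  refine MeasurableSet.inter ?_ (hQ.preimage (measurable_pi_iff.mpr fun i =>
    ((measurable_orderStat i).div_const t).ennreal_toReal))
  change MeasurableSet {u : Fin n → ENNReal | ∀ i, u i < t}
  rw [Set.ofPred_forall]
  exact MeasurableSet.iInter fun i => measurableSet_lt (measurable_pi_apply i) measurable_const

theorem isLowerSet_ratioSet_one {n : ℕ} {Q : Set (Fin n → ℝ)} (hQ : IsLowerSet Q) :
    IsLowerSet (ratioSet Q 1) := by
  intro u w hwu hu
  refine ⟨fun i => (hwu i).trans_lt (hu.1 i), hQ (fun i => ?_) hu.2⟩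
  have h1 : orderStat u i < 1 := hu.1 _
  exact ENNReal.toReal_mono (by simpa using h1.ne_top) (by simpa using orderStat_mono hwu i)

theorem preimage_div_ratioSet {n : ℕ} (Q : Set (Fin n → ℝ)) {t : ENNReal} (h0 : t ≠ 0)
    (ht : t ≠ ⊤) : (fun (u : Fin n → ENNReal) i => u i / t) ⁻¹' ratioSet Q 1 = ratioSet Q t := by
  ext u
  have hmono : Monotone fun y : ENNReal => y / t := fun a b hab => ENNReal.div_le_div_right hab t
  have h := orderStat_comp_monotone u hmono
  have h' : ∀ i, orderStat (fun i => u i / t) i = orderStat u i / t := fun i => congrFun h i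
  have hlt : ∀ i, u i / t < 1 ↔ u i < t := fun i => by
    rw [ENNReal.div_lt_iff (Or.inl h0) (Or.inl ht), one_mul]
  simp only [ratioSet, Set.mem_preimage, Set.mem_ofPred_eq, h', hlt, div_one]

theorem sampleLaw_ratioSet {n : ℕ} {Q : Set (Fin n → ℝ)} (hQ : MeasurableSet Q) {t : ENNReal}
    (h0 : t ≠ 0) (ht : t ≠ ⊤) (β : Fin n → EReal) :
    sampleLaw β (ratioSet Q t) =
      Measure.pi (fun i => (noncentralChiSq (β i)).map (· / t)) (ratioSet Q 1) := by
  have : ∀ i, IsProbabilityMeasure ((noncentralChiSq (β i)).map (· / t)) := fun i =>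
    Measure.isProbabilityMeasure_map (by fun_prop)
  rw [← Measure.pi_map_pi (fun i => by fun_prop),
    Measure.map_apply (by fun_prop) (measurableSet_ratioSet hQ 1), preimage_div_ratioSet Q h0 ht]
  rfl

/-- Comparison of the conditional probabilities, given that the sample lies below a threshold: they
are largest for central variables, where they increase with the threshold. -/
theorem sampleLaw_ratioSet_mul_le {n : ℕ} {Q : Set (Fin n → ℝ)} (hQ : IsLowerSet Q)
    (hQm : MeasurableSet Q) {t t' : ENNReal} (h0 : t ≠ 0) (htt : t ≤ t') (ht' : t' ≠ ⊤)
    (β : Fin n → EReal) :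
    sampleLaw β (ratioSet Q t) * noncentralChiSq 0 (Set.Iio t') ^ n ≤
      sampleLaw (fun _ : Fin n => 0) (ratioSet Q t') *
        ∏ i, noncentralChiSq (β i) (Set.Iio t) := by
  have ht : t ≠ ⊤ := ne_top_of_le_ne_top ht' htt
  have h0' : t' ≠ 0 := (h0.bot_lt.trans_le htt).ne'
  have hp : ∀ b (t : ENNReal), IsProbabilityMeasure ((noncentralChiSq b).map (· / t)) := fun b t =>
    Measure.isProbabilityMeasure_map (by fun_prop)
  have hIio : ∀ b (t : ENNReal), t ≠ 0 → t ≠ ⊤ →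
      (noncentralChiSq b).map (· / t) (Set.Iio 1) = noncentralChiSq b (Set.Iio t) := by
    intro b t h0 ht
    rw [Measure.map_apply (by fun_prop) measurableSet_Iio]
    congr 1
    ext y
    simp [ENNReal.div_lt_iff (Or.inl h0) (Or.inl ht)]
  have key := pi_lowerSet_mul_le (fun i => (noncentralChiSq (β i)).map (· / t))
    (fun _ : Fin n => (noncentralChiSq 0).map (· / t'))
    (fun i => (noncentralChiSq (β i)).map (· / t) (Set.Iio 1))
    (fun _ => (noncentralChiSq 0).map (· / t') (Set.Iio 1))
    (fun i => measure_ne_top _ _) (fun i => measure_ne_top _ _) (B := Set.Iio 1)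
    (fun i A hA hA1 => noncentralChiSq_map_div_mul_le (β i) h0 htt ht' hA hA1)
    (isLowerSet_ratioSet_one hQ) (measurableSet_ratioSet hQm 1) (fun u hu i => hu.1 i)
  rw [sampleLaw_ratioSet hQm h0 ht, sampleLaw_ratioSet hQm h0' ht']
  simpa [hIio _ _ h0 ht, hIio _ _ h0' ht'] using key

/-- The probability, given that `n` central variables lie below `t`, that their ordered values
divided by `t` lie in `Q`. -/
noncomputable def condRatioProb {n : ℕ} (Q : Set (Fin n → ℝ)) (t : ENNReal) : ENNReal :=
  sampleLaw (fun _ : Fin n => 0) (ratioSet Q t) / noncentralChiSq 0 (Set.Iio t) ^ n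

/-- The conditional rejection probability of central variables given that the last order statistic
entering the test equals `t`, for the region with ratios in `Q` and last order statistic in `V`.
The supremum makes it monotone on all of `[0, ∞]`; for `0 < t < ∞` it has the value
`condRatioProb Q t` if `t ∈ V`, and `0` otherwise. -/
noncomputable def condRejProb {n : ℕ} (Q : Set (Fin n → ℝ)) (V : Set ℝ) (t : ENNReal) : ENNReal :=
  ⨆ t' ∈ {t' : ENNReal | t' ≠ 0 ∧ t' ≠ ⊤ ∧ t' ≤ t ∧ t'.toReal ∈ V}, condRatioProb Q t'

theorem monotone_condRejProb {n : ℕ} (Q : Set (Fin n → ℝ)) (V : Set ℝ) :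
    Monotone (condRejProb Q V) := fun _ _ h =>
  biSup_mono fun _ ht => ⟨ht.1, ht.2.1, ht.2.2.1.trans h, ht.2.2.2⟩

theorem noncentralChiSq_zero_Iio_pow_ne_zero {t : ENNReal} (h0 : t ≠ 0) (n : ℕ) :
    noncentralChiSq 0 (Set.Iio t) ^ n ≠ 0 :=
  pow_ne_zero _ (noncentralChiSq_zero_Iio_pos (pos_iff_ne_zero.mpr h0)).ne'

theorem noncentralChiSq_zero_Iio_pow_ne_top (t : ENNReal) (n : ℕ) :
    noncentralChiSq 0 (Set.Iio t) ^ n ≠ ⊤ := ENNReal.pow_ne_top (measure_ne_top _ _)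

theorem condRatioProb_mono {n : ℕ} {Q : Set (Fin n → ℝ)} (hQ : IsLowerSet Q)
    (hQm : MeasurableSet Q) {t t' : ENNReal} (h0 : t ≠ 0) (htt : t ≤ t') (ht' : t' ≠ ⊤) :
    condRatioProb Q t ≤ condRatioProb Q t' := by
  have h0' : t' ≠ 0 := (h0.bot_lt.trans_le htt).ne'
  have := sampleLaw_ratioSet_mul_le hQ hQm h0 htt ht' (fun _ => 0)
  simp only [Finset.prod_const, Finset.card_univ, Fintype.card_fin] at this
  unfold condRatioProb
  rw [ENNReal.div_le_iff (noncentralChiSq_zero_Iio_pow_ne_zero h0 n)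
    (noncentralChiSq_zero_Iio_pow_ne_top t n), ← ENNReal.mul_div_right_comm,
    ENNReal.le_div_iff_mul_le (Or.inl (noncentralChiSq_zero_Iio_pow_ne_zero h0' n))
    (Or.inl (noncentralChiSq_zero_Iio_pow_ne_top t' n))]
  exact this

theorem condRejProb_of_mem {n : ℕ} {Q : Set (Fin n → ℝ)} (hQ : IsLowerSet Q)
    (hQm : MeasurableSet Q) {V : Set ℝ} {t : ENNReal} (h0 : t ≠ 0) (ht : t ≠ ⊤)
    (htV : t.toReal ∈ V) : condRejProb Q V t = condRatioProb Q t :=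
  le_antisymm (iSup₂_le fun _ h => condRatioProb_mono hQ hQm h.1 h.2.2.1 ht)
    (le_iSup₂ (f := fun t' (_ : t' ∈ {t' : ENNReal | t' ≠ 0 ∧ t' ≠ ⊤ ∧ t' ≤ t ∧ t'.toReal ∈ V}) =>
      condRatioProb Q t') t ⟨h0, ht, le_rfl, htV⟩)

theorem condRejProb_of_notMem {n : ℕ} (Q : Set (Fin n → ℝ)) {V : Set ℝ} (hV : IsUpperSet V)
    {t : ENNReal} (ht : t ≠ ⊤) (htV : t.toReal ∉ V) : condRejProb Q V t = 0 := by
  refine le_antisymm (iSup₂_le fun t' h => ?_) zero_le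
  exact absurd (hV (ENNReal.toReal_mono ht h.2.2.1) h.2.2.2) htV

theorem sampleLaw_ratioSet_and_le {n : ℕ} {Q : Set (Fin n → ℝ)} (hQ : IsLowerSet Q)
    (hQm : MeasurableSet Q) {V : Set ℝ} {t : ENNReal} (h0 : t ≠ 0) (ht : t ≠ ⊤)
    (β : Fin n → EReal) :
    sampleLaw β {u | u ∈ ratioSet Q t ∧ t.toReal ∈ V} ≤
      condRejProb Q V t * ∏ i, noncentralChiSq (β i) (Set.Iio t) := by
  by_cases htV : t.toReal ∈ V
  · simp only [htV, and_true, Set.ofPred_mem_eq]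
    rw [condRejProb_of_mem hQ hQm h0 ht htV, condRatioProb, ← ENNReal.mul_div_right_comm,
      ENNReal.le_div_iff_mul_le (Or.inl (noncentralChiSq_zero_Iio_pow_ne_zero h0 n))
      (Or.inl (noncentralChiSq_zero_Iio_pow_ne_top t n))]
    exact sampleLaw_ratioSet_mul_le hQ hQm h0 le_rfl ht β
  · simp [htV]

theorem sampleLaw_ratioSet_and_eq {n : ℕ} {Q : Set (Fin n → ℝ)} (hQ : IsLowerSet Q)
    (hQm : MeasurableSet Q) {V : Set ℝ} (hV : IsUpperSet V) {t : ENNReal} (h0 : t ≠ 0) (ht : t ≠ ⊤)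
    {β : Fin n → EReal} (hβ : ∀ i, β i = 0 ∨ β i = ⊤) :
    sampleLaw β {u | u ∈ ratioSet Q t ∧ t.toReal ∈ V} =
      condRejProb Q V t * ∏ i, noncentralChiSq (β i) (Set.Iio t) := by
  by_cases hβ0 : ∀ i, β i = 0
  · obtain rfl : β = fun _ => 0 := funext hβ0
    by_cases htV : t.toReal ∈ V
    · simp only [htV, and_true, Set.ofPred_mem_eq, Finset.prod_const, Finset.card_univ,
        Fintype.card_fin]
      rw [condRejProb_of_mem hQ hQm h0 ht htV, condRatioProb,
        ENNReal.div_mul_cancel (noncentralChiSq_zero_Iio_pow_ne_zero h0 n)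
        (noncentralChiSq_zero_Iio_pow_ne_top t n)]
    · simp [htV, condRejProb_of_notMem Q hV ht htV]
  · obtain ⟨i, hi⟩ := not_forall.mp hβ0
    have hprod : ∏ i, noncentralChiSq (β i) (Set.Iio t) = 0 :=
      Finset.prod_eq_zero (Finset.mem_univ i) (by
        rw [(hβ i).resolve_left hi, noncentralChiSq_top, Measure.dirac_apply' _ measurableSet_Iio]
        simp)
    have hle := sampleLaw_ratioSet_and_le hQ hQm h0 ht β (V := V)
    rw [hprod, mul_zero] at hle ⊢
    exact le_antisymm hle zero_le

/-! ### Decomposition by the set of the smallest values -/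

/-- Samples whose values indexed by `J` are the smallest ones. -/
def lowBlock {k : ℕ} (J : Finset (Fin k)) : Set (Fin k → ENNReal) :=
  {x | ∀ i ∈ J, ∀ j ∉ J, x i < x j}

theorem measurableSet_lowBlock {k : ℕ} (J : Finset (Fin k)) : MeasurableSet (lowBlock J) := by
  have : lowBlock J = ⋂ i ∈ J, ⋂ j ∈ Jᶜ, {x : Fin k → ENNReal | x i < x j} := by
    ext x; simp [lowBlock]
  rw [this]
  exact J.measurableSet_biInter fun i _ => Jᶜ.measurableSet_biInter fun j _ =>
    measurableSet_lt (measurable_pi_apply i) (measurable_pi_apply j)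

theorem pairwiseDisjoint_lowBlock (k n : ℕ) :
    (↑(Finset.powersetCard n (Finset.univ : Finset (Fin k))) : Set (Finset (Fin k))).PairwiseDisjoint
      lowBlock := by
  intro J hJ J' hJ' hne
  rw [Finset.mem_coe, Finset.mem_powersetCard] at hJ hJ'
  refine Set.disjoint_left.mpr fun x hx hx' => hne ?_
  obtain ⟨i, hi, hi'⟩ : ∃ i ∈ J, i ∉ J' := by
    by_contra! hsub
    exact hne (Finset.eq_of_subset_of_card_le hsub (by omega))
  obtain ⟨j, hj, hj'⟩ : ∃ j ∈ J', j ∉ J := by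
    by_contra! hsub
    exact hne (Finset.eq_of_subset_of_card_le hsub (by omega)).symm
  exact absurd (hx i hi j hj') (lt_asymm (hx' j hj i hi'))

theorem exists_mem_lowBlock {k n : ℕ} (hn : n < k) {x : Fin k → ENNReal}
    (htop : orderStat x ⟨n, hn⟩ ≠ ⊤) (hties : ∀ i j, i ≠ j → x i = x j → x i = ⊤) :
    ∃ J ∈ Finset.powersetCard n (Finset.univ : Finset (Fin k)), x ∈ lowBlock J := by
  refine ⟨(Finset.univ.filter fun a : Fin k => (a : ℕ) < n).map (Tuple.sort x).toEmbedding, ?_, ?_⟩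
  · rw [Finset.mem_powersetCard]
    refine ⟨Finset.subset_univ _, ?_⟩
    rw [Finset.card_map, Fin.card_filter_val_lt, min_eq_right hn.le]
  · intro i hi j hj
    obtain ⟨a, ha, rfl⟩ := Finset.mem_map.mp hi
    obtain ⟨b, rfl⟩ := (Tuple.sort x).surjective j
    have ha' : (a : ℕ) < n := by simpa using ha
    have hb : ¬ (b : ℕ) < n := fun hb => hj (Finset.mem_map.mpr ⟨b, by simpa using hb, rfl⟩)
    have hab : a < b := Fin.lt_def.mpr (by omega)
    have hle : orderStat x a ≤ orderStat x b := monotone_orderStat x hab.le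
    have hfin : orderStat x a ≠ ⊤ := ne_top_of_le_ne_top htop
      (monotone_orderStat x (Fin.le_def.mpr ha'.le))
    exact lt_of_le_of_ne hle fun heq => hfin
      (hties _ _ (fun h => hab.ne ((Tuple.sort x).injective h)) heq)

/-- The samples in `[0, ∞]^k` for which the ratios `X_i / X_{n+1}`, `i ≤ n`, lie in `Q` and
`X_{n+1}` lies in `V`. -/
def ratioRegion {k n : ℕ} (hn : n < k) (Q : Set (Fin n → ℝ)) (V : Set ℝ) :
    Set (Fin k → ENNReal) :=
  {x | (fun i : Fin n => (orderStat x ⟨i, i.2.trans hn⟩ / orderStat x ⟨n, hn⟩).toReal) ∈ Q ∧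
    (orderStat x ⟨n, hn⟩).toReal ∈ V}

theorem measurableSet_ratioRegion {k n : ℕ} (hn : n < k) {Q : Set (Fin n → ℝ)} {V : Set ℝ}
    (hQ : MeasurableSet Q) (hV : MeasurableSet V) : MeasurableSet (ratioRegion hn Q V) :=
  (hQ.preimage (measurable_pi_iff.mpr fun _ =>
    ((measurable_orderStat _).div (measurable_orderStat _)).ennreal_toReal)).inter
    (hV.preimage (measurable_orderStat _).ennreal_toReal)

theorem measurePreserving_split {n r k : ℕ} (e : Fin n ⊕ Fin r ≃ Fin k) (β : Fin k → EReal) :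
    MeasurePreserving
      (fun x : Fin k → ENNReal => (fun a => x (e (Sum.inl a)), fun b => x (e (Sum.inr b))))
      (sampleLaw β)
      ((sampleLaw fun a => β (e (Sum.inl a))).prod (sampleLaw fun b => β (e (Sum.inr b)))) :=
  (measurePreserving_sumPiEquivProdPi fun i => noncentralChiSq (β (e i))).comp
    (measurePreserving_piCongrLeft (fun i => noncentralChiSq (β i)) e).symm

theorem lt_iInf_fin_iff {r : ℕ} (z : Fin (r + 1) → ENNReal) (t : ENNReal) :
    t < ⨅ b, z b ↔ ∀ b, t < z b := by
  refine ⟨fun h b => h.trans_le (iInf_le _ _), fun h => ?_⟩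
  obtain ⟨b, hb⟩ := exists_eq_ciInf_of_finite (f := z)
  exact hb ▸ h b

theorem mem_lowBlock_iff {n r k : ℕ} (e : Fin n ⊕ Fin (r + 1) ≃ Fin k) {J : Finset (Fin k)}
    (hl : ∀ a, e (Sum.inl a) ∈ J) (hr : ∀ b, e (Sum.inr b) ∉ J) (x : Fin k → ENNReal) :
    x ∈ lowBlock J ↔ ∀ a, x (e (Sum.inl a)) < ⨅ b, x (e (Sum.inr b)) := by
  simp only [lt_iInf_fin_iff]
  refine ⟨fun h a b => h _ (hl a) _ (hr b), fun h i hi j hj => ?_⟩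
  obtain ⟨i | i, rfl⟩ := e.surjective i
  · obtain ⟨j | j, rfl⟩ := e.surjective j
    · exact absurd (hl j) hj
    · exact h i j
  · exact absurd hi (hr i)

/-- If the first block of a sample lies below the second, the `(n + 1)`-st order statistic is the
minimum of the second block. -/
theorem orderStat_eq_iInf_of_block {n r k : ℕ} (hn : n < k) (hk : n + (r + 1) = k)
    (e : Fin n ⊕ Fin (r + 1) ≃ Fin k) {x : Fin k → ENNReal}
    (hx : ∀ a, x (e (Sum.inl a)) < ⨅ b, x (e (Sum.inr b))) :
    orderStat x ⟨n, hn⟩ = ⨅ b, x (e (Sum.inr b)) := by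
  have h := (orderStat_split hk e x fun a b => (hx a).le.trans (iInf_le _ _)).2 0
  rw [orderStat_zero_eq_iInf] at h
  exact h

theorem mem_ratioRegion_iff_of_block {n r k : ℕ} (hn : n < k) (hk : n + (r + 1) = k)
    (e : Fin n ⊕ Fin (r + 1) ≃ Fin k) (Q : Set (Fin n → ℝ)) (V : Set ℝ) {x : Fin k → ENNReal}
    (hx : ∀ a, x (e (Sum.inl a)) < ⨅ b, x (e (Sum.inr b))) :
    x ∈ ratioRegion hn Q V ↔
      (fun a => x (e (Sum.inl a))) ∈ ratioSet Q (⨅ b, x (e (Sum.inr b))) ∧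
        (⨅ b, x (e (Sum.inr b))).toReal ∈ V := by
  have h := (orderStat_split hk e x fun a b => (hx a).le.trans (iInf_le _ _)).1
  simp only [ratioRegion, ratioSet, Set.mem_ofPred_eq, orderStat_eq_iInf_of_block hn hk e hx, h]
  simp [hx]

theorem measurable_iInf_fin (r : ℕ) : Measurable fun z : Fin r → ENNReal => ⨅ b, z b :=
  Measurable.iInf fun b => measurable_pi_apply b

theorem sampleLaw_ratioRegion_inter_lowBlock {n r k : ℕ} (hn : n < k) (hk : n + (r + 1) = k)
    (e : Fin n ⊕ Fin (r + 1) ≃ Fin k) {J : Finset (Fin k)}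
    (hl : ∀ a, e (Sum.inl a) ∈ J) (hr : ∀ b, e (Sum.inr b) ∉ J) (β : Fin k → EReal)
    {Q : Set (Fin n → ℝ)} {V : Set ℝ} (hQ : MeasurableSet Q) (hV : MeasurableSet V) :
    sampleLaw β (ratioRegion hn Q V ∩ lowBlock J) =
      ∫⁻ z, sampleLaw (fun a => β (e (Sum.inl a)))
        {u | u ∈ ratioSet Q (⨅ b, z b) ∧ (⨅ b, z b).toReal ∈ V}
        ∂sampleLaw (fun b => β (e (Sum.inr b))) := by
  set S : Set ((Fin n → ENNReal) × (Fin (r + 1) → ENNReal)) :=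
    {p | p.1 ∈ ratioSet Q (⨅ b, p.2 b) ∧ (⨅ b, p.2 b).toReal ∈ V} with hS
  have hT : Measurable fun p : (Fin n → ENNReal) × (Fin (r + 1) → ENNReal) => ⨅ b, p.2 b :=
    (measurable_iInf_fin _).comp measurable_snd
  have hSm : MeasurableSet S := by
    refine MeasurableSet.inter (MeasurableSet.inter ?_ ?_) (hV.preimage hT.ennreal_toReal)
    · change MeasurableSet {p : (Fin n → ENNReal) × (Fin (r + 1) → ENNReal) |
        ∀ i, p.1 i < ⨅ b, p.2 b}
      rw [Set.ofPred_forall]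
      exact MeasurableSet.iInter fun i =>
        measurableSet_lt ((measurable_pi_apply i).comp measurable_fst) hT
    · exact hQ.preimage (measurable_pi_iff.mpr fun i =>
        (((measurable_orderStat i).comp measurable_fst).div hT).ennreal_toReal)
  have hpre : ratioRegion hn Q V ∩ lowBlock J =
      (fun x : Fin k → ENNReal => ((fun a => x (e (Sum.inl a)), fun b => x (e (Sum.inr b))) :
        (Fin n → ENNReal) × (Fin (r + 1) → ENNReal))) ⁻¹' S := by
    ext x
    rw [Set.mem_inter_iff, mem_lowBlock_iff e hl hr]
    constructor
    · rintro ⟨hx, hlow⟩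
      exact (mem_ratioRegion_iff_of_block hn hk e Q V hlow).mp hx
    · intro hx
      have hlow : ∀ a, x (e (Sum.inl a)) < ⨅ b, x (e (Sum.inr b)) := hx.1.1
      exact ⟨(mem_ratioRegion_iff_of_block hn hk e Q V hlow).mpr hx, hlow⟩
  rw [hpre, (measurePreserving_split e β).measure_preimage hSm.nullMeasurableSet,
    Measure.prod_apply_symm hSm]
  rfl

theorem setLIntegral_lowBlock {n r k : ℕ} (hn : n < k) (hk : n + (r + 1) = k)
    (e : Fin n ⊕ Fin (r + 1) ≃ Fin k) {J : Finset (Fin k)}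
    (hl : ∀ a, e (Sum.inl a) ∈ J) (hr : ∀ b, e (Sum.inr b) ∉ J) (β : Fin k → EReal)
    {H : ENNReal → ENNReal} (hH : Measurable H) :
    ∫⁻ x in lowBlock J, H (orderStat x ⟨n, hn⟩) ∂sampleLaw β =
      ∫⁻ z, H (⨅ b, z b) * ∏ a, noncentralChiSq (β (e (Sum.inl a))) (Set.Iio (⨅ b, z b))
        ∂sampleLaw (fun b => β (e (Sum.inr b))) := by
  set S : Set ((Fin n → ENNReal) × (Fin (r + 1) → ENNReal)) :=
    {p | ∀ a, p.1 a < ⨅ b, p.2 b} with hS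
  have hT : Measurable fun p : (Fin n → ENNReal) × (Fin (r + 1) → ENNReal) => ⨅ b, p.2 b :=
    (measurable_iInf_fin _).comp measurable_snd
  have hSm : MeasurableSet S := by
    rw [hS, Set.ofPred_forall]
    exact MeasurableSet.iInter fun i =>
      measurableSet_lt ((measurable_pi_apply i).comp measurable_fst) hT
  have hG : Measurable (S.indicator fun p => H (⨅ b, p.2 b)) := (hH.comp hT).indicator hSm
  have hcomp : ∀ x : Fin k → ENNReal,
      (lowBlock J).indicator (fun x => H (orderStat x ⟨n, hn⟩)) x =
        S.indicator (fun p => H (⨅ b, p.2 b))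
          (fun a => x (e (Sum.inl a)), fun b => x (e (Sum.inr b))) := by
    intro x
    by_cases hx : x ∈ lowBlock J
    · have hlow := (mem_lowBlock_iff e hl hr x).mp hx
      rw [Set.indicator_of_mem hx, Set.indicator_of_mem (by exact hlow),
        orderStat_eq_iInf_of_block hn hk e hlow]
    · rw [Set.indicator_of_notMem hx, Set.indicator_of_notMem]
      exact fun h => hx ((mem_lowBlock_iff e hl hr x).mpr h)
  rw [← lintegral_indicator (measurableSet_lowBlock J), lintegral_congr hcomp,
    (measurePreserving_split e β).lintegral_comp hG, lintegral_prod_symm' _ hG]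
  refine lintegral_congr fun z => ?_
  have hbox : (fun u => S.indicator (fun p => H (⨅ b, p.2 b)) (u, z)) =
      (Set.univ.pi fun _ : Fin n => Set.Iio (⨅ b, z b)).indicator fun _ => H (⨅ b, z b) := by
    ext u
    by_cases hu : ∀ a, u a < ⨅ b, z b
    · rw [Set.indicator_of_mem (by exact hu), Set.indicator_of_mem (by simpa using hu)]
    · rw [Set.indicator_of_notMem (by exact hu), Set.indicator_of_notMem (by simpa using hu)]
  rw [hbox, lintegral_indicator (MeasurableSet.univ_pi fun _ => measurableSet_Iio),
    setLIntegral_const, sampleLaw, Measure.pi_pi]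

/-- Almost surely exactly one set of `n` indices carries the `n` smallest values. -/
theorem lintegral_eq_sum_lowBlock {k n : ℕ} (hn : n < k) {β : Fin k → EReal}
    (hβ : n < numZeros β) (f : (Fin k → ENNReal) → ENNReal) :
    ∫⁻ x, f x ∂sampleLaw β =
      ∑ J ∈ Finset.powersetCard n Finset.univ, ∫⁻ x in lowBlock J, f x ∂sampleLaw β := by
  rw [← lintegral_biUnion_finset (pairwiseDisjoint_lowBlock k n)
    fun J _ => measurableSet_lowBlock J, ← setLIntegral_univ]
  refine setLIntegral_congr ?_
  filter_upwards [ae_sampleLaw_ne_top β, ae_sampleLaw_eq_top_of_eq β] with x hx hties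
  obtain ⟨J, hJ, hxJ⟩ := exists_mem_lowBlock hn (orderStat_ne_top hn hβ hx) hties
  have : x ∈ ⋃ J ∈ Finset.powersetCard n (Finset.univ : Finset (Fin k)), lowBlock J :=
    Set.mem_biUnion hJ hxJ
  exact propext ⟨fun _ => this, fun _ => trivial⟩

theorem sampleLaw_eq_sum_lowBlock {k n : ℕ} (hn : n < k) {β : Fin k → EReal}
    (hβ : n < numZeros β) {R : Set (Fin k → ENNReal)} (hR : MeasurableSet R) :
    sampleLaw β R =
      ∑ J ∈ Finset.powersetCard n Finset.univ, sampleLaw β (R ∩ lowBlock J) := by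
  have h := lintegral_eq_sum_lowBlock hn hβ (R.indicator 1)
  simp only [lintegral_indicator_one hR] at h
  rw [h]
  exact Finset.sum_congr rfl fun J _ => by rw [Measure.restrict_apply hR]

/-- Almost surely the minimum over a block containing a zero effect is positive and finite. -/
theorem ae_iInf_ne_zero_and_ne_top {r : ℕ} {β : Fin (r + 1) → EReal} (hβ : ∃ b, β b = 0) :
    ∀ᵐ z ∂sampleLaw β, (⨅ b, z b) ≠ 0 ∧ (⨅ b, z b) ≠ ⊤ := by
  obtain ⟨b, hb⟩ := hβ
  filter_upwards [ae_sampleLaw_ne_zero β, ae_sampleLaw_ne_top β] with z h0 htop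
  refine ⟨?_, ne_top_of_le_ne_top (htop b hb) (iInf_le _ b)⟩
  obtain ⟨b', hb'⟩ := exists_eq_ciInf_of_finite (f := z)
  exact hb' ▸ h0 b'

/-- More than `n` zero effects cannot all be indexed by a set of `n` indices. -/
theorem exists_zero_of_card {k n r : ℕ} (e : Fin n ⊕ Fin r ≃ Fin k) {β : Fin k → EReal}
    (hβ : n < numZeros β) : ∃ b, β (e (Sum.inr b)) = 0 := by
  by_contra! hcon
  have hsub : Finset.univ.filter (fun i => β i = 0) ⊆
      (Finset.univ : Finset (Fin n)).image fun a => e (Sum.inl a) := by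
    intro i hi
    obtain ⟨a | b, rfl⟩ := e.surjective i
    · exact Finset.mem_image_of_mem _ (Finset.mem_univ a)
    · exact absurd (by simpa using hi) (hcon b)
  have h1 := (Finset.card_le_card hsub).trans Finset.card_image_le
  rw [Finset.card_univ, Fintype.card_fin] at h1
  exact absurd h1 (not_le.mpr hβ)

theorem exists_equiv_of_mem_powersetCard {k n r : ℕ} (hk : n + (r + 1) = k) {J : Finset (Fin k)}
    (hJ : J ∈ Finset.powersetCard n (Finset.univ : Finset (Fin k))) :
    ∃ e : Fin n ⊕ Fin (r + 1) ≃ Fin k,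
      (∀ a, e (Sum.inl a) ∈ J) ∧ ∀ b, e (Sum.inr b) ∉ J := by
  have hc := (Finset.mem_powersetCard.mp hJ).2
  have hcc : Jᶜ.card = r + 1 := by
    rw [Finset.card_compl, Fintype.card_fin]; omega
  refine ⟨finSumEquivOfFinset hc hcc, fun a => ?_, fun b => ?_⟩
  · rw [finSumEquivOfFinset_inl]; exact Finset.orderEmbOfFin_mem _ _ _
  · rw [finSumEquivOfFinset_inr, ← Finset.mem_compl]; exact Finset.orderEmbOfFin_mem _ _ _

/-- The rejection probability is at most the expected value of the conditional rejection probability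
of central variables at the order statistic `X_{n+1}`. -/
theorem sampleLaw_ratioRegion_le {k n : ℕ} (hn : n < k) {β : Fin k → EReal}
    (hβ : n < numZeros β) {Q : Set (Fin n → ℝ)} (hQ : IsLowerSet Q) (hQm : MeasurableSet Q)
    {V : Set ℝ} (hV : IsUpperSet V) :
    sampleLaw β (ratioRegion hn Q V) ≤
      ∫⁻ x, condRejProb Q V (orderStat x ⟨n, hn⟩) ∂sampleLaw β := by
  obtain ⟨r, hr⟩ : ∃ r, n + (r + 1) = k := ⟨k - n - 1, by omega⟩
  rw [sampleLaw_eq_sum_lowBlock hn hβ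
    (measurableSet_ratioRegion hn hQm hV.ordConnected.measurableSet), lintegral_eq_sum_lowBlock hn hβ]
  refine Finset.sum_le_sum fun J hJ => ?_
  obtain ⟨e, heJ, heJ'⟩ := exists_equiv_of_mem_powersetCard hr hJ
  rw [sampleLaw_ratioRegion_inter_lowBlock hn hr e heJ heJ' β hQm hV.ordConnected.measurableSet,
    setLIntegral_lowBlock hn hr e heJ heJ' β (monotone_condRejProb Q V).measurable]
  refine lintegral_mono_ae ?_
  filter_upwards [ae_iInf_ne_zero_and_ne_top (exists_zero_of_card e hβ)] with z hz
  exact sampleLaw_ratioSet_and_le hQ hQm hz.1 hz.2 _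

/-- If all effects are zero or infinite, the bound `sampleLaw_ratioRegion_le` is an equality. -/
theorem sampleLaw_ratioRegion_eq {k n : ℕ} (hn : n < k) {β : Fin k → EReal}
    (hβ : n < numZeros β) (hβ' : ∀ i, β i = 0 ∨ β i = ⊤) {Q : Set (Fin n → ℝ)}
    (hQ : IsLowerSet Q) (hQm : MeasurableSet Q) {V : Set ℝ} (hV : IsUpperSet V) :
    sampleLaw β (ratioRegion hn Q V) =
      ∫⁻ x, condRejProb Q V (orderStat x ⟨n, hn⟩) ∂sampleLaw β := by
  obtain ⟨r, hr⟩ : ∃ r, n + (r + 1) = k := ⟨k - n - 1, by omega⟩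
  rw [sampleLaw_eq_sum_lowBlock hn hβ
    (measurableSet_ratioRegion hn hQm hV.ordConnected.measurableSet), lintegral_eq_sum_lowBlock hn hβ]
  refine Finset.sum_congr rfl fun J hJ => ?_
  obtain ⟨e, heJ, heJ'⟩ := exists_equiv_of_mem_powersetCard hr hJ
  rw [sampleLaw_ratioRegion_inter_lowBlock hn hr e heJ heJ' β hQm hV.ordConnected.measurableSet,
    setLIntegral_lowBlock hn hr e heJ heJ' β (monotone_condRejProb Q V).measurable]
  refine lintegral_congr_ae ?_
  filter_upwards [ae_iInf_ne_zero_and_ne_top (exists_zero_of_card e hβ)] with z hz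
  exact sampleLaw_ratioSet_and_eq hQ hQm hV hz.1 hz.2 fun a => hβ' _

/-! ### Boundaries of lower sets are negligible -/

theorem pi_absolutelyContinuous {n : ℕ} (μ ν : Fin n → Measure ℝ) [∀ i, SigmaFinite (μ i)]
    [∀ i, SigmaFinite (ν i)] (h : ∀ i, μ i ≪ ν i) : Measure.pi μ ≪ Measure.pi ν := by
  induction n with
  | zero =>
    have : μ = ν := funext fun i => i.elim0
    rw [this]
  | succ n ih =>
    have hμ := (measurePreserving_piFinSuccAbove μ 0).symm.map_eq
    have hν := (measurePreserving_piFinSuccAbove ν 0).symm.map_eq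
    rw [← hμ, ← hν]
    exact ((h 0).prod (ih _ _ fun i => h _)).map (MeasurableEquiv.measurable _)

theorem sampleLaw_ratioSet_frontier {n : ℕ} {Q : Set (Fin n → ℝ)} (hQ : IsLowerSet Q)
    {t : ENNReal} (h0 : t ≠ 0) (ht : t ≠ ⊤) :
    sampleLaw (fun _ : Fin n => 0) (ratioSet (frontier Q) t) = 0 := by
  set ρ := ((noncentralChiSq 0).map (· / t)).map ENNReal.toReal with hρ
  have hρ' : ρ = (noncentralChiSq 0).map fun y => (y / t).toReal :=
    Measure.map_map (by fun_prop) (by fun_prop)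
  have hprob : IsProbabilityMeasure ((noncentralChiSq 0).map fun y => (y / t).toReal) :=
    Measure.isProbabilityMeasure_map (by fun_prop)
  have hmap : (sampleLaw fun _ : Fin n => 0).map (fun u i => (u i / t).toReal) =
      Measure.pi fun _ : Fin n => (noncentralChiSq 0).map fun y => (y / t).toReal :=
    Measure.pi_map_pi (f := fun _ y => (y / t).toReal) fun i => by fun_prop
  have hac : (sampleLaw fun _ : Fin n => 0).map (fun u i => (u i / t).toReal) ≪
      (volume : Measure (Fin n → ℝ)) := by
    rw [hmap, volume_pi]
    refine pi_absolutelyContinuous _ _ fun i => ?_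
    rw [← hρ']
    exact noncentralChiSq_zero_map_div_toReal_absolutelyContinuous h0 ht
  -- the order statistics are one of the finitely many rearrangements of the sample
  refine measure_mono_null (t := ⋃ σ : Equiv.Perm (Fin n),
    (fun u i => (u i / t).toReal) ⁻¹' {v : Fin n → ℝ | v ∘ σ ∈ frontier Q}) ?_ ?_
  · intro u hu
    exact Set.mem_iUnion.mpr ⟨Tuple.sort u, hu.2⟩
  · refine measure_iUnion_null fun σ => ?_
    have hm : MeasurableSet {v : Fin n → ℝ | v ∘ σ ∈ frontier Q} :=
      isClosed_frontier.measurableSet.preimage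
        (measurable_pi_iff.mpr fun i => measurable_pi_apply (σ i))
    rw [← Measure.map_apply (by fun_prop) hm]
    refine hac ?_
    have := (volume_measurePreserving_piCongrLeft (fun _ : Fin n => ℝ) σ).symm.measure_preimage_equiv
      (frontier Q)
    rw [hQ.null_frontier] at this
    exact this

theorem condRejProb_closure_eq_interior {n : ℕ} {Q : Set (Fin n → ℝ)} (hQ : IsLowerSet Q)
    (V : Set ℝ) : condRejProb (closure Q) V = condRejProb (interior Q) V := by
  funext t
  refine iSup_congr fun t' => iSup_congr fun h => ?_
  unfold condRatioProb
  congr 1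
  apply le_antisymm
  · have hsub : ratioSet (closure Q) t' ⊆ ratioSet (interior Q) t' ∪ ratioSet (frontier Q) t' := by
      intro u hu
      have hu2 := hu.2
      rw [closure_eq_interior_union_frontier] at hu2
      exact hu2.imp (fun h => ⟨hu.1, h⟩) fun h => ⟨hu.1, h⟩
    calc _ ≤ _ := measure_mono hsub
      _ ≤ _ := measure_union_le _ _
      _ = _ := by rw [sampleLaw_ratioSet_frontier hQ h.1 h.2.1, add_zero]
  · exact measure_mono fun u hu => ⟨hu.1, interior_subset.trans subset_closure hu.2⟩

/-! ### Comparison with the least favourable configuration -/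

/-- Keeps the `m` coordinates selected by `τ` and replaces the others by `+∞`. -/
noncomputable def keepFirst {k : ℕ} (m : ℕ) (τ : Equiv.Perm (Fin k)) (x : Fin k → ENNReal) :
    Fin k → ENNReal := fun i => if (i : ℕ) < m then x (τ i) else ⊤

theorem measurePreserving_keepFirst {k m : ℕ} {τ : Equiv.Perm (Fin k)} {β : Fin k → EReal}
    (hβ : ∀ i : Fin k, (i : ℕ) < m → β (τ i) = 0) :
    MeasurePreserving (keepFirst m τ) (sampleLaw β) (sampleLaw (leastFavorable k m)) := by
  have h1 : MeasurePreserving (fun x : Fin k → ENNReal => fun i => x (τ i)) (sampleLaw β)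
      (sampleLaw fun i => β (τ i)) :=
    (measurePreserving_piCongrLeft (fun i => noncentralChiSq (β i)) τ).symm
  let f : Fin k → ENNReal → ENNReal := fun i y => if (i : ℕ) < m then y else ⊤
  have hf : ∀ i, Measurable (f i) := fun i => by
    by_cases hi : (i : ℕ) < m <;> simp only [f, hi, if_true, if_false] <;> fun_prop
  have hfm : ∀ i, (noncentralChiSq (β (τ i))).map (f i) =
      noncentralChiSq (leastFavorable k m i) := fun i => by
    by_cases hi : (i : ℕ) < m
    · simp [f, hi, leastFavorable, hβ i hi]
    · simp [f, hi, leastFavorable, noncentralChiSq_top]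
  have hprob : ∀ i, IsProbabilityMeasure ((noncentralChiSq (β (τ i))).map (f i)) := fun i =>
    Measure.isProbabilityMeasure_map (hf i).aemeasurable
  have h2 : MeasurePreserving (fun (x : Fin k → ENNReal) i => f i (x i))
      (sampleLaw fun i => β (τ i)) (sampleLaw (leastFavorable k m)) := by
    refine ⟨measurable_pi_iff.mpr fun i => (hf i).comp (measurable_pi_apply i), ?_⟩
    unfold sampleLaw
    rw [Measure.pi_map_pi fun i => (hf i).aemeasurable]
    simp_rw [hfm]
  exact h2.comp h1

theorem exists_perm_zero {k m : ℕ} {β : Fin k → EReal} (hβ : β ∈ nullHyp k m) (hmk : m ≤ k) :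
    ∃ τ : Equiv.Perm (Fin k), ∀ i : Fin k, (i : ℕ) < m → β (τ i) = 0 := by
  obtain ⟨I, hI, hIc⟩ := Finset.exists_subset_card_eq (show m ≤ _ from hβ)
  have hcard : Fintype.card {i : Fin k // (i : ℕ) < m} = Fintype.card {i // i ∈ I} := by
    rw [Fintype.card_subtype, Fin.card_filter_val_lt, Fintype.card_coe, hIc, min_eq_right hmk]
  let e := Fintype.equivOfCardEq hcard
  refine ⟨e.extendSubtype, fun i hi => ?_⟩
  simpa using hI (e.extendSubtype_mem i hi)

/-- The order statistics increase stochastically when nonzero effects become infinite. -/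
theorem lintegral_orderStat_le_leastFavorable {k m : ℕ} (hmk : m ≤ k) {β : Fin k → EReal}
    (hβ : β ∈ nullHyp k m) {H : ENNReal → ENNReal} (hH : Monotone H) (i : Fin k) :
    ∫⁻ x, H (orderStat x i) ∂sampleLaw β ≤
      ∫⁻ x, H (orderStat x i) ∂sampleLaw (leastFavorable k m) := by
  obtain ⟨τ, hτ⟩ := exists_perm_zero hβ hmk
  rw [← (measurePreserving_keepFirst hτ).lintegral_comp (f := fun x => H (orderStat x i))
    (hH.measurable.comp (measurable_orderStat i))]
  refine lintegral_mono fun x => hH ?_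
  calc orderStat x i = orderStat (x ∘ τ) i := by rw [orderStat_comp_perm]
    _ ≤ _ := orderStat_mono (fun j => by by_cases hj : (j : ℕ) < m <;> simp [keepFirst, hj]) i

theorem numZeros_leastFavorable {k m : ℕ} (hmk : m ≤ k) : numZeros (leastFavorable k m) = m := by
  have : ∀ i : Fin k, leastFavorable k m i = 0 ↔ (i : ℕ) < m := fun i => by
    by_cases hi : (i : ℕ) < m <;> simp [leastFavorable, hi]
  simp only [numZeros, this]
  rw [Fin.card_filter_val_lt, min_eq_right hmk]

theorem sampleLaw_ratioRegion_closure_le {k m n : ℕ} (hn : n < k) (hnm : n < m) (hmk : m ≤ k)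
    {β : Fin k → EReal} (hβ : β ∈ nullHyp k m) {Q : Set (Fin n → ℝ)} (hQ : IsLowerSet Q)
    {V : Set ℝ} (hV : IsUpperSet V) :
    sampleLaw β (ratioRegion hn (closure Q) V) ≤
      sampleLaw (leastFavorable k m) (ratioRegion hn (interior Q) V) := by
  rw [sampleLaw_ratioRegion_eq hn (hnm.trans_eq (numZeros_leastFavorable hmk).symm)
    (fun i => by by_cases hi : (i : ℕ) < m <;> simp [leastFavorable, hi]) hQ.interior
    isOpen_interior.measurableSet hV, ← condRejProb_closure_eq_interior hQ]
  exact (sampleLaw_ratioRegion_le hn (hnm.trans_le hβ) hQ.closure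
    isClosed_closure.measurableSet hV).trans
    (lintegral_orderStat_le_leastFavorable hmk hβ (monotone_condRejProb _ _) _)

/-! ### Approximation by real effects -/

/-- The real effects `(0, …, 0, b, …, b)` whose first `m` components are zero. -/
def realEffects (k m : ℕ) (b : ℝ) : Fin k → ℝ := fun i => if (i : ℕ) < m then 0 else b

theorem realEffects_mem_nullHyp {k m : ℕ} (hmk : m ≤ k) (b : ℝ) :
    (fun i => (realEffects k m b i : EReal)) ∈ nullHyp k m := by
  have hsub : (Finset.univ.filter fun i : Fin k => (i : ℕ) < m) ⊆
      Finset.univ.filter fun i => (realEffects k m b i : EReal) = 0 := by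
    intro i hi
    have hi' : (i : ℕ) < m := by simpa using hi
    simp [realEffects, hi']
  have := Finset.card_le_card hsub
  rw [Fin.card_filter_val_lt, min_eq_right hmk] at this
  exact this

/-- If the first `m` values lie below the others, replacing the others by `+∞` does not change the
`m` smallest order statistics. -/
theorem orderStat_keepFirst {k m : ℕ} (hmk : m ≤ k) {x : Fin k → ENNReal}
    (hx : ∀ i j : Fin k, (i : ℕ) < m → m ≤ (j : ℕ) → x i ≤ x j) (i : Fin k) (hi : (i : ℕ) < m) :
    orderStat (keepFirst m 1 x) i = orderStat x i := by
  obtain ⟨r, rfl⟩ := Nat.exists_eq_add_of_le hmk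
  have h1 := (orderStat_split rfl finSumFinEquiv x fun a b => hx _ _ (by simp) (by simp)).1 ⟨i, hi⟩
  have h2 := (orderStat_split rfl finSumFinEquiv (keepFirst m 1 x)
    fun a b => by simp [keepFirst]).1 ⟨i, hi⟩
  have h3 : (fun a => keepFirst m 1 x (finSumFinEquiv (Sum.inl a))) =
      fun a : Fin m => x (finSumFinEquiv (n := r) (Sum.inl a)) := by
    ext a; simp [keepFirst]
  rw [h3] at h2
  exact h2.trans h1.symm

theorem noncentralChiSq_zero_Ioi_le {b : ℝ} :
    noncentralChiSq ((0 : ℝ) : EReal) (Set.Ioi (ENNReal.ofReal (b ^ 2 / 4))) ≤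
      gaussianReal 0 1 {x | b / 2 ≤ |x|} := by
  rw [noncentralChiSq_coe, Measure.map_apply (by fun_prop) measurableSet_Ioi]
  refine measure_mono fun x hx => ?_
  have h1 : b ^ 2 / 4 < x ^ 2 := (ENNReal.ofReal_lt_ofReal_iff_of_nonneg (by positivity)).mp hx
  have h2 : |b / 2| < |x| := sq_lt_sq.mp (by nlinarith)
  exact (le_abs_self _).trans h2.le

theorem noncentralChiSq_Iio_le {b : ℝ} (hb : 0 ≤ b) :
    noncentralChiSq (b : EReal) (Set.Iio (ENNReal.ofReal (b ^ 2 / 4))) ≤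
      gaussianReal 0 1 {x | b / 2 ≤ |x|} := by
  have hg : gaussianReal b 1 = (gaussianReal 0 1).map (· + b) := by
    rw [gaussianReal_map_add_const, zero_add]
  rw [noncentralChiSq_coe, hg, Measure.map_map (by fun_prop) (by fun_prop),
    Measure.map_apply (by fun_prop) measurableSet_Iio]
  refine measure_mono fun x hx => ?_
  have h1 : (x + b) ^ 2 < b ^ 2 / 4 := by
    by_contra! hle
    exact absurd hx (not_lt.mpr (ENNReal.ofReal_le_ofReal hle))
  have h2 : |x + b| < b / 2 := abs_lt_of_sq_lt_sq (by nlinarith) (by positivity)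
  have h3 := (abs_lt.mp h2).2
  change b / 2 ≤ |x|
  linarith [neg_abs_le x]

theorem sampleLaw_leastFavorable_le {k m n : ℕ} (hn : n < k) (hnm : n < m) (hmk : m ≤ k)
    {Q : Set (Fin n → ℝ)} (hQ : MeasurableSet Q) {V : Set ℝ} (hV : MeasurableSet V)
    {b : ℝ} (hb : 0 ≤ b) :
    sampleLaw (leastFavorable k m) (ratioRegion hn Q V) ≤
      sampleLaw (fun i => (realEffects k m b i : EReal)) (ratioRegion hn Q V) +
        k * gaussianReal 0 1 {x | b / 2 ≤ |x|} := by
  set β : Fin k → EReal := fun i => (realEffects k m b i : EReal) with hβ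
  have hmp : MeasurePreserving (keepFirst m 1) (sampleLaw β) (sampleLaw (leastFavorable k m)) :=
    measurePreserving_keepFirst fun i hi => by simp [hβ, realEffects, hi]
  rw [← hmp.measure_preimage (measurableSet_ratioRegion hn hQ hV).nullMeasurableSet]
  set L := ENNReal.ofReal (b ^ 2 / 4)
  -- the events that a value lies on the wrong side of the level `L`
  let bad : Fin k → Set ENNReal := fun i => if (i : ℕ) < m then Set.Ioi L else Set.Iio L
  have hbad : ∀ i, sampleLaw β (Function.eval i ⁻¹' bad i) ≤ gaussianReal 0 1 {x | b / 2 ≤ |x|} := by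
    intro i
    have hm : MeasurableSet (bad i) := by
      by_cases hi : (i : ℕ) < m
      · simp [bad, hi]
      · simp [bad, hi]
    have hev : MeasurePreserving (Function.eval i) (sampleLaw β) (noncentralChiSq (β i)) :=
      measurePreserving_eval (fun i => noncentralChiSq (β i)) i
    rw [hev.measure_preimage hm.nullMeasurableSet]
    by_cases hi : (i : ℕ) < m
    · simp only [hβ, realEffects, bad, hi, if_true]
      exact noncentralChiSq_zero_Ioi_le
    · simp only [hβ, realEffects, bad, hi, if_false]
      exact noncentralChiSq_Iio_le hb
  have hsub : keepFirst m 1 ⁻¹' ratioRegion hn Q V ⊆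
      ratioRegion hn Q V ∪ ⋃ i, Function.eval i ⁻¹' bad i := by
    intro x hx
    by_cases hxb : ∃ i, x i ∈ bad i
    · obtain ⟨i, hi⟩ := hxb
      exact Or.inr (Set.mem_iUnion.mpr ⟨i, hi⟩)
    · push Not at hxb
      have hord := orderStat_keepFirst hmk (x := x) fun i j hi hj => by
        have h1 := hxb i
        have h2 := hxb j
        simp only [bad, hi, if_true, Set.mem_Ioi, not_lt] at h1
        simp only [bad, not_lt.mpr hj, if_false, Set.mem_Iio, not_lt] at h2
        exact h1.trans h2
      refine Or.inl ?_
      have hx' : keepFirst m 1 x ∈ ratioRegion hn Q V := hx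
      have h1 := hord ⟨n, hn⟩ hnm
      have h2 : ∀ i : Fin n, _ := fun i => hord ⟨i, i.2.trans hn⟩ (i.2.trans hnm)
      simpa only [ratioRegion, Set.mem_ofPred_eq, h1, h2] using hx'
  calc _ ≤ sampleLaw β (ratioRegion hn Q V ∪ ⋃ i, Function.eval i ⁻¹' bad i) := measure_mono hsub
    _ ≤ sampleLaw β (ratioRegion hn Q V) + ∑ i, sampleLaw β (Function.eval i ⁻¹' bad i) :=
      (measure_union_le _ _).trans (by gcongr; exact measure_iUnion_fintype_le _ _)
    _ ≤ sampleLaw β (ratioRegion hn Q V) + ∑ _i : Fin k, gaussianReal 0 1 {x | b / 2 ≤ |x|} := by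
      gcongr with i; exact hbad i
    _ = _ := by simp

theorem tendsto_gaussianReal_tail :
    Filter.Tendsto (fun b : ℕ => gaussianReal 0 1 {x : ℝ | (b : ℝ) / 2 ≤ |x|}) Filter.atTop
      (nhds 0) := by
  have hempty : ⋂ b : ℕ, {x : ℝ | (b : ℝ) / 2 ≤ |x|} = ∅ := by
    ext x
    simp only [Set.mem_iInter, Set.mem_ofPred_eq, Set.mem_empty_iff_false, iff_false, not_forall,
      not_le]
    obtain ⟨b, hb⟩ := exists_nat_gt (2 * |x|)
    exact ⟨b, by linarith⟩
  have h := tendsto_measure_iInter_atTop (μ := gaussianReal 0 1)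
    (s := fun b : ℕ => {x : ℝ | (b : ℝ) / 2 ≤ |x|})
    (fun b => (measurableSet_le measurable_const (by fun_prop)).nullMeasurableSet)
    (fun b c hbc x hx => by
      have : (b : ℝ) ≤ c := by exact_mod_cast hbc
      have hx' : (c : ℝ) / 2 ≤ |x| := hx
      change (b : ℝ) / 2 ≤ |x|
      linarith) ⟨0, measure_ne_top _ _⟩
  rwa [hempty, measure_empty] at h

/-! ### Scale-invariant tests -/

/-- Rejection by a scale-invariant test is determined by the ratios, which have to lie in a lower
set, unless `TL` vanishes, in which case it is determined by the last order statistic. -/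
theorem exists_lowerSet_upperSet {n : ℕ} {TL : (Fin n → ℝ) → ℝ} {TR : ℝ → ℝ}
    (hTL : MonotoneOn TL {x | ∀ i, 0 < x i}) (hTR : MonotoneOn TR (Set.Ioi 0))
    (hTR0 : ∀ y : ℝ, 0 < y → TR y ≠ 0)
    (hinv : ∀ a : ℝ, 0 < a → ∀ x : Fin n → ℝ, (∀ i, 0 < x i) → ∀ y : ℝ, 0 < y →
      TL (fun i => a * x i) / TR (a * y) = TL x / TR y) :
    ∃ (Q : Set (Fin n → ℝ)) (V : Set ℝ), IsLowerSet Q ∧ IsUpperSet V ∧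
      ∀ x : Fin n → ℝ, (∀ i, 0 < x i) → ∀ y : ℝ, 0 < y →
        (TL x < TR y ↔ (fun i => x i / y) ∈ Q ∧ y ∈ V) := by
  by_cases h0 : ∀ x : Fin n → ℝ, (∀ i, 0 < x i) → TL x = 0
  · refine ⟨Set.univ, {y | ∃ v, 0 < v ∧ v ≤ y ∧ 0 < TR v}, isLowerSet_univ,
      fun y z hyz ⟨v, hv, hvy, hTv⟩ => ⟨v, hv, hvy.trans hyz, hTv⟩, fun x hx y hy => ?_⟩
    rw [h0 x hx]
    refine ⟨fun h => ⟨trivial, y, hy, le_rfl, h⟩, fun ⟨_, v, hv, hvy, hTv⟩ => ?_⟩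
    exact hTv.trans_le (hTR hv hy hvy)
  · push Not at h0
    obtain ⟨x₀, hx₀, hne⟩ := h0
    refine ⟨{u | ∃ w, (∀ i, 0 < w i) ∧ u ≤ w ∧ TL w < TR 1}, Set.univ,
      fun u v hvu ⟨w, hw, huw, hTw⟩ => ⟨w, hw, hvu.trans huw, hTw⟩, isUpperSet_univ,
      fun x hx y hy => ?_⟩
    -- scaling by `√y` twice exhibits `TR y / TR 1` as a square
    set c := √y
    have hc : 0 < c := Real.sqrt_pos.mpr hy
    have hcc : c * c = y := Real.mul_self_sqrt hy.le
    have hg : ∀ z, 0 < z → TR (c * z) = TL (fun i => c * x₀ i) / TL x₀ * TR z := by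
      intro z hz
      have := hinv c hc x₀ hx₀ z hz
      rw [div_eq_div_iff (hTR0 _ (mul_pos hc hz)) (hTR0 z hz)] at this
      field_simp
      linarith
    set g := TL (fun i => c * x₀ i) / TL x₀
    have hTy : TR y = g ^ 2 * TR 1 := by
      have h1 := hg 1 one_pos
      rw [← hcc, hg c hc]
      rw [mul_one] at h1
      rw [h1]
      ring
    have hg2 : 0 < g ^ 2 := by
      have : g ≠ 0 := fun h => hTR0 y hy (by rw [hTy, h]; ring)
      positivity
    have hxy : ∀ i, 0 < x i / y := fun i => div_pos (hx i) hy
    have hTx : TL x = g ^ 2 * TL (fun i => x i / y) := by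
      have h1 := hinv y hy (fun i => x i / y) hxy 1 one_pos
      have h2 : (fun i => y * (x i / y)) = x := by
        ext i; field_simp
      have h3 := hTR0 1 one_pos
      rw [h2, mul_one, hTy, div_eq_div_iff (by positivity) h3] at h1
      exact mul_right_cancel₀ h3 (by linarith)
    rw [hTx, hTy, mul_lt_mul_iff_right₀ hg2]
    refine ⟨fun h => ⟨⟨_, hxy, le_rfl, h⟩, trivial⟩, fun ⟨⟨w, hw, hle, hTw⟩, _⟩ => ?_⟩
    exact (hTL hxy hw hle).trans_lt hTw

/-- On samples with positive values and finite `X_s`, rejection is decided by the ratios and by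
`X_s`. -/
theorem mem_rejectionRegion_iff {k s : ℕ} (hs : 1 < s) (hsk : s ≤ k) {TL : (Fin (s - 1) → ℝ) → ℝ}
    {TR : ℝ → ℝ} {Q : Set (Fin (s - 1) → ℝ)} {V : Set ℝ}
    (h : ∀ x : Fin (s - 1) → ℝ, (∀ i, 0 < x i) → ∀ y : ℝ, 0 < y →
      (TL x < TR y ↔ (fun i => x i / y) ∈ Q ∧ y ∈ V))
    (hn : s - 1 < k) {x : Fin k → ENNReal} (hx : ∀ i, x i ≠ 0)
    (htop : orderStat x ⟨s - 1, hn⟩ ≠ ⊤) :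
    x ∈ rejectionRegion hs hsk TL TR ↔ x ∈ ratioRegion hn Q V := by
  have hpos : ∀ i : Fin k, i ≤ ⟨s - 1, hn⟩ → 0 < (orderStat x i).toReal := fun i hi =>
    ENNReal.toReal_pos (orderStat_ne_zero hx i) (ne_top_of_le_ne_top htop (monotone_orderStat x hi))
  have := h (fun i => (orderStat x ⟨i, i.2.trans hn⟩).toReal)
    (fun i => hpos _ (Fin.le_def.mpr i.2.le)) (orderStat x ⟨s - 1, hn⟩).toReal (hpos _ le_rfl)
  simpa only [rejectionRegion, ratioRegion, Set.mem_ofPred_eq, ENNReal.toReal_div] using this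

theorem theorem1 (k m s : ℕ) (hs : 1 < s) (hsm : s ≤ m) (hmk : m ≤ k)
    (TL : (Fin (s - 1) → ℝ) → ℝ) (TR : ℝ → ℝ)
    (hTL : MonotoneOn TL {x | ∀ i, 0 < x i})
    (hTR : MonotoneOn TR (Set.Ioi 0))
    (hTR0 : ∀ y : ℝ, 0 < y → TR y ≠ 0)
    (hinv : ∀ a : ℝ, 0 < a → ∀ x : Fin (s - 1) → ℝ, (∀ i, 0 < x i) → ∀ y : ℝ, 0 < y →
      TL (fun i => a * x i) / TR (a * y) = TL x / TR y) :
    -- the supremum over all real parameter vectors with at least `m` zeros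
    (⨆ β ∈ {β : Fin k → ℝ | (fun i => (β i : EReal)) ∈ nullHyp k m},
        sampleLaw (fun i => (β i : EReal)) (rejectionRegion hs (hsm.trans hmk) TL TR)) =
      sampleLaw (leastFavorable k m) (rejectionRegion hs (hsm.trans hmk) TL TR) ∧
    -- over the parameter vectors with possibly infinite effects, it is attained
    leastFavorable k m ∈ nullHyp k m ∧
    ∀ β ∈ nullHyp k m,
      sampleLaw β (rejectionRegion hs (hsm.trans hmk) TL TR) ≤
        sampleLaw (leastFavorable k m) (rejectionRegion hs (hsm.trans hmk) TL TR) := by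
  obtain ⟨Q, V, hQ, hV, hQV⟩ := exists_lowerSet_upperSet hTL hTR hTR0 hinv
  have hn : s - 1 < k := by omega
  have hnm : s - 1 < m := by omega
  have hmem : ∀ β ∈ nullHyp k m, ∀ᵐ x ∂sampleLaw β,
      (x ∈ rejectionRegion hs (hsm.trans hmk) TL TR ↔ x ∈ ratioRegion hn Q V) := by
    intro β hβ
    filter_upwards [ae_sampleLaw_ne_zero β, ae_sampleLaw_ne_top β] with x h0 htop
    exact mem_rejectionRegion_iff hs (hsm.trans hmk) hQV hn h0
      (orderStat_ne_top hn (hnm.trans_le hβ) htop)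
  have hle : ∀ β ∈ nullHyp k m, sampleLaw β (rejectionRegion hs (hsm.trans hmk) TL TR) ≤
      sampleLaw β (ratioRegion hn (closure Q) V) := by
    intro β hβ
    refine measure_mono_ae ?_
    filter_upwards [hmem β hβ] with x hx hxR
    have hxQ := hx.mp hxR
    exact ⟨subset_closure hxQ.1, hxQ.2⟩
  have hge : ∀ β ∈ nullHyp k m, sampleLaw β (ratioRegion hn (interior Q) V) ≤
      sampleLaw β (rejectionRegion hs (hsm.trans hmk) TL TR) := by
    intro β hβ
    refine measure_mono_ae ?_
    filter_upwards [hmem β hβ] with x hx hxR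
    exact hx.mpr ⟨interior_subset hxR.1, hxR.2⟩
  have hlf : leastFavorable k m ∈ nullHyp k m := (numZeros_leastFavorable hmk).ge
  have hmax : ∀ β ∈ nullHyp k m, sampleLaw β (rejectionRegion hs (hsm.trans hmk) TL TR) ≤
      sampleLaw (leastFavorable k m) (rejectionRegion hs (hsm.trans hmk) TL TR) := fun β hβ =>
    (hle β hβ).trans ((sampleLaw_ratioRegion_closure_le hn hnm hmk hβ hQ hV).trans (hge _ hlf))
  refine ⟨le_antisymm (iSup₂_le fun β hβ => hmax _ hβ) ?_, hlf, hmax⟩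
  set p := ⨆ β ∈ {β : Fin k → ℝ | (fun i => (β i : EReal)) ∈ nullHyp k m},
    sampleLaw (fun i => (β i : EReal)) (rejectionRegion hs (hsm.trans hmk) TL TR)
  have hbound : ∀ b : ℕ, sampleLaw (leastFavorable k m)
      (rejectionRegion hs (hsm.trans hmk) TL TR) ≤
        p + k * gaussianReal 0 1 {x : ℝ | (b : ℝ) / 2 ≤ |x|} := by
    intro b
    have hb := realEffects_mem_nullHyp hmk (b : ℝ)
    calc _ ≤ _ := hle _ hlf
      _ ≤ _ := sampleLaw_ratioRegion_closure_le hn hnm hmk hlf hQ hV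
      _ ≤ _ := sampleLaw_leastFavorable_le hn hnm hmk isOpen_interior.measurableSet
        hV.ordConnected.measurableSet (Nat.cast_nonneg b)
      _ ≤ _ := by
        gcongr
        exact (hge _ hb).trans (le_iSup₂ (f := fun (β : Fin k → ℝ)
          (_ : β ∈ {β : Fin k → ℝ | (fun i => (β i : EReal)) ∈ nullHyp k m}) =>
            sampleLaw (fun i => (β i : EReal)) (rejectionRegion hs (hsm.trans hmk) TL TR)) _ hb)
  have hlim : Filter.Tendsto
      (fun b : ℕ => p + k * gaussianReal 0 1 {x : ℝ | (b : ℝ) / 2 ≤ |x|}) Filter.atTop (nhds p) := by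
    simpa using tendsto_const_nhds.add
      (ENNReal.Tendsto.const_mul tendsto_gaussianReal_tail (Or.inr (ENNReal.natCast_ne_top k)))
  exact ge_of_tendsto hlim (Filter.Eventually.of_forall hbound)
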